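/- Let $n \ge 2$ and let $\Phi = [0,1]^n$ be the feature space of a classification model with $m$ classes whose output at $x \in \Phi$ is $z = Wx + b$, where $W \in \mathbb{R}^{m\times n}$ and $b \in \mathbb{R}^m$. Write $W[i]$ for the $i$-th row of $W$. Let $i, j$ be two classes with $W[i] \neq W[j]$, and let the decision boundary between them be $$\Delta^{i,j}_\phi = \{x \in \Phi : (W[i]-W[j])\,x = -b[i]+b[j],\ \ W[i]x+b[i] \ge W[k]x+b[k]\ \text{ for all } k \notin \{i,j\}\}.$$ 1. $\Delta^{i,j}_\phi$ is a (possibly empty) convex polytope, i.e. the convex hull of a finite set of points, and its dimension is at most $n-1$ (the empty set is assigned dimension $0$). 2. The volume of $\Delta^{i,j}_\phi$ can be computed by the following simplex-type enumeration of its vertices, applied to the linear system consisting of the equation above, the constraints $x_k \ge 0$, $-x_k \ge -1$ ($1\le k\le n$) and the inequalities for the classes $k\notin\{i,j\}$. An inequality is *binding* at a point if it holds there with equality. A *basic feasible solution* is a solution of the system at which the normals of the equation and of the binding inequalities span $\mathbb{R}^n$. An *edge direction* at $s$ is a vector $d \ne 0$ that is orthogonal to $W[i]-W[j]$, has nonnegative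 inner product with the normal of every inequality binding at $s$, and is such that the normal of the equation together with the normals of those inequalities binding at $s$ that are orthogonal to $d$ have rank $n-1$. - Start with $S = \{s\}$ for some basic feasible solution $s$, or with $S = \emptyset$ if there is none. - As long as this is possible, choose some $s \in S$ and an edge direction $d$ at $s$ such that the point $s + td$, with $t$ the largest real number for which $s+td$ satisfies the system, is not in $S$, and add this point to $S$. Whatever choices are made, the enumeration stops after finitely many steps; there is a completed run; and at the end of every completed run $S$ is exactly the set of vertices (extreme points) of $\Delta^{i,j}_\phi$, so that $\Delta^{i,j}_\phi$ is the convex hull of $S$. The $(n-1)$-dimensional volume of $\Delta^{i,j}_\phi$ is then obtained from $S$ by breaking the polytope into simplices: it equals $$\sum_{(p_0,\dots,p_{n-1})\in T_{n-1}(S)} \frac{1}{(n-1)!}\sqrt{\det\big(\langle p_k-p_0,\,p_l-p_0\rangle\big)_{1\le k,l\le n-1}},$$ where $T_0(F) = F$ and, for $d \ge 0$, $T_{d+1}(F)$ is obtained by choosing a point $v \in F$ (by an arbitrary fixed rule that depends only on $F$) and collecting all tuples $(v,p_0,\dots,p_d)$ with $(p_0,\dots,p_d)\in T_d(F')$, where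 $F'$ ranges over the sets $\{x \in F : c \text{ is binding at } x\}$, $c$ an inequality of the system, that do not contain $v$ ($T_{d+1}(\emptyset)=\emptyset$). 3. If $w = W[i]-W[j]$ has no zero entry, then, with $\mathbb{1}_K \in \{0,1\}^n$ the indicator vector of $K$, $$vol_{n-1}(\Delta^{i,j}_\phi) \le \frac{\|W[i]-W[j]\|_2}{(n-1)!\,\prod_{k=1}^n (W[i,k]-W[j,k])} \sum_{K\subseteq\{1,\dots,n\}} (-1)^{|K|}\big(\max(0,\,-b[i]+b[j]-w\cdot \mathbb{1}_K)\big)^{n-1}.$$ Here $vol_{n-1}$ is the $(n-1)$-dimensional Hausdorff measure, normalized to agree with Lebesgue measure on $(n-1)$-dimensional Euclidean spaces. -/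

import Mathlib

open MeasureTheory
open scoped RealInnerProductSpace Classical Matrix

noncomputable section

/-- The feature space `[0,1]^n`, with its Euclidean structure. -/
def unitCube (n : ℕ) : Set (EuclideanSpace ℝ (Fin n)) :=
  {x | ∀ k, 0 ≤ x k ∧ x k ≤ 1}

/-- The output `z = W x + b` of the last layer at the feature vector `x`. -/
def modelOutput {n m : ℕ} (W : Matrix (Fin m) (Fin n) ℝ) (b : Fin m → ℝ)
    (x : EuclideanSpace ℝ (Fin n)) : Fin m → ℝ :=
  W *ᵥ x.ofLp + b

/-- The decision boundary between the classes `i` and `j`: the points of the feature space at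
which the outputs of `i` and `j` agree and are at least the output of every other class. -/
def decisionBoundary {n m : ℕ} (W : Matrix (Fin m) (Fin n) ℝ) (b : Fin m → ℝ) (i j : Fin m) :
    Set (EuclideanSpace ℝ (Fin n)) :=
  {x | x ∈ unitCube n ∧ modelOutput W b x i = modelOutput W b x j ∧
    ∀ k, k ≠ i → k ≠ j → modelOutput W b x k ≤ modelOutput W b x i}

/-- A convex polytope is the convex hull of a finite (possibly empty) set of points. -/
def IsConvexPolytope {n : ℕ} (P : Set (EuclideanSpace ℝ (Fin n))) : Prop :=
  ∃ V : Finset (EuclideanSpace ℝ (Fin n)), P = convexHull ℝ (V : Set (EuclideanSpace ℝ (Fin n)))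

/-- The dimension of a set is the dimension of (the direction of) its affine hull;
it is `0` for the empty set. -/
def affineDim {n : ℕ} (P : Set (EuclideanSpace ℝ (Fin n))) : ℕ :=
  Module.finrank ℝ (vectorSpan ℝ P)

/-- The data of a linear system in `ℝⁿ`: one equation `⟪eqNormal, x⟫ = eqRhs` and finitely many
inequalities `⟪normal c, x⟫ ≥ rhs c`. -/
structure LinearSystem (n : ℕ) (ι : Type) where
  eqNormal : EuclideanSpace ℝ (Fin n)
  eqRhs : ℝ
  normal : ι → EuclideanSpace ℝ (Fin n)
  rhs : ι → ℝ

namespace LinearSystem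

variable {n : ℕ} {ι : Type}

/-- `x` satisfies the system. -/
def Feasible (L : LinearSystem n ι) (x : EuclideanSpace ℝ (Fin n)) : Prop :=
  ⟪L.eqNormal, x⟫ = L.eqRhs ∧ ∀ c, L.rhs c ≤ ⟪L.normal c, x⟫

/-- The inequality `c` is binding (holds with equality) at `x`. -/
def Binding (L : LinearSystem n ι) (c : ι) (x : EuclideanSpace ℝ (Fin n)) : Prop :=
  ⟪L.normal c, x⟫ = L.rhs c

/-- A basic feasible solution: a feasible point at which the normals of the equation and of the
binding inequalities span the whole space. -/
def IsBasicFeasible (L : LinearSystem n ι) (s : EuclideanSpace ℝ (Fin n)) : Prop :=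
  L.Feasible s ∧
    Submodule.span ℝ (insert L.eqNormal (L.normal '' {c | L.Binding c s})) = ⊤

/-- `d` is an edge direction at `s`: it respects the equation and all inequalities that are binding
at `s`, and the constraints that remain binding along `d` have rank `n - 1`, so that they
determine the line through `s` in direction `d`. -/
def IsEdgeDirection (L : LinearSystem n ι) (s d : EuclideanSpace ℝ (Fin n)) : Prop :=
  d ≠ 0 ∧ ⟪L.eqNormal, d⟫ = 0 ∧ (∀ c, L.Binding c s → 0 ≤ ⟪L.normal c, d⟫) ∧
    Module.finrank ℝ (Submodule.span ℝ
      (insert L.eqNormal (L.normal '' {c | L.Binding c s ∧ ⟪L.normal c, d⟫ = 0}))) + 1 = n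

/-- The start of the enumeration: a basic feasible solution, if there is one
(and nothing otherwise). -/
def Start (L : LinearSystem n ι) (S : Finset (EuclideanSpace ℝ (Fin n))) : Prop :=
  (∃ s, L.IsBasicFeasible s ∧ S = {s}) ∨ ((∀ s, ¬ L.IsBasicFeasible s) ∧ S = ∅)

/-- One step of the enumeration: from a point `s` found before, move along an edge direction `d`
as far as the system stays satisfied, and record the point reached there, which must be new. -/
def Step (L : LinearSystem n ι) (S S' : Finset (EuclideanSpace ℝ (Fin n))) : Prop :=
  ∃ s ∈ S, ∃ d, L.IsEdgeDirection s d ∧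
    ∃ t : ℝ, IsGreatest {t : ℝ | L.Feasible (s + t • d)} t ∧
      s + t • d ∉ S ∧ S' = insert (s + t • d) S

/-- `S` is the result of a completed run: it is reached from a start by finitely many steps, and
no further step is possible. -/
def IsOutput (L : LinearSystem n ι) (S : Finset (EuclideanSpace ℝ (Fin n))) : Prop :=
  ∃ S₀, L.Start S₀ ∧ Relation.ReflTransGen L.Step S₀ S ∧ ∀ S', ¬ L.Step S S'

variable [Fintype ι]

/-- Breaking a polytope with vertex set `S` into simplices with `d + 1` vertices each. For `d = 0`
the simplices are the single points of `S`. Otherwise one vertex of `S` is chosen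
(by the rule `pick`), every face that is cut out by one binding inequality and does not contain
that vertex is broken into simplices with `d` vertices, and the chosen vertex is put in front. -/
def simplices (L : LinearSystem n ι)
    (pick : Finset (EuclideanSpace ℝ (Fin n)) → EuclideanSpace ℝ (Fin n)) :
    (d : ℕ) → Finset (EuclideanSpace ℝ (Fin n)) →
      Finset (Fin (d + 1) → EuclideanSpace ℝ (Fin n))
  | 0, S => S.image fun v _ => v
  | d + 1, S =>
      ((Finset.univ.image fun c => S.filter fun x => L.Binding c x).filter
          fun F => pick S ∉ F).biUnion
        fun F => (simplices L pick d F).image fun p => Fin.cons (pick S) p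

end LinearSystem

/-- The `d`-volume of the simplex with vertices `p 0, …, p d`, through the Gram determinant of its
edge vectors at `p 0`. -/
def simplexVolume {n d : ℕ} (p : Fin (d + 1) → EuclideanSpace ℝ (Fin n)) : ℝ :=
  Real.sqrt (Matrix.gram ℝ fun k : Fin d => p k.succ - p 0).det / (d.factorial : ℝ)

/-- The `d`-volume computed from a list `S` of vertices: the sum of the volumes of the simplices
into which the polytope is broken. -/
def volumeFromVertices {n : ℕ} {ι : Type} [Fintype ι] (L : LinearSystem n ι)
    (pick : Finset (EuclideanSpace ℝ (Fin n)) → EuclideanSpace ℝ (Fin n)) (d : ℕ)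
    (S : Finset (EuclideanSpace ℝ (Fin n))) : ℝ :=
  ∑ p ∈ L.simplices pick d S, simplexVolume p

/-- Labels of the inequalities of the decision boundary between `i` and `j`: the constraints
`0 ≤ x k`, the constraints `x k ≤ 1`, and one constraint for each class other than `i` and `j`. -/
abbrev BoundaryIneq (n : ℕ) {m : ℕ} (i j : Fin m) : Type :=
  Fin n ⊕ Fin n ⊕ {k : Fin m // k ≠ i ∧ k ≠ j}

/-- The linear system that defines the decision boundary between `i` and `j`. -/
def boundarySystem {n m : ℕ} (W : Matrix (Fin m) (Fin n) ℝ) (b : Fin m → ℝ) (i j : Fin m) :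
    LinearSystem n (BoundaryIneq n i j) where
  eqNormal := WithLp.toLp 2 (W i - W j)
  eqRhs := -b i + b j
  normal := Sum.elim (fun k => EuclideanSpace.single k 1)
    (Sum.elim (fun k => -EuclideanSpace.single k 1) fun k => WithLp.toLp 2 (W i - W k))
  rhs := Sum.elim (fun _ => 0) (Sum.elim (fun _ => -1) fun k => -b i + b k)

/-- The system describes the decision boundary. -/
theorem feasible_boundarySystem_iff {n m : ℕ} (W : Matrix (Fin m) (Fin n) ℝ) (b : Fin m → ℝ)
    (i j : Fin m) (x : EuclideanSpace ℝ (Fin n)) :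
    (boundarySystem W b i j).Feasible x ↔ x ∈ decisionBoundary W b i j := by
  have key : ∀ k l : Fin m, ⟪(WithLp.toLp 2 (W k - W l) : EuclideanSpace ℝ (Fin n)), x⟫
      = (W *ᵥ x.ofLp) k - (W *ᵥ x.ofLp) l := by
    intro k l
    simp [EuclideanSpace.inner_eq_star_dotProduct, Matrix.mulVec, dotProduct_comm,
      dotProduct_sub]
  simp only [LinearSystem.Feasible, boundarySystem, decisionBoundary, unitCube, modelOutput,
    Set.mem_ofPred_eq, key, Sum.forall, Sum.elim_inl, Sum.elim_inr, inner_neg_left,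
    EuclideanSpace.inner_single_left, Subtype.forall, Pi.add_apply, map_one, one_mul]
  constructor
  · rintro ⟨h1, h2, h3, h4⟩
    exact ⟨fun k => ⟨h2 k, by linarith [h3 k]⟩, by linarith,
      fun k hi hj => by linarith [h4 k ⟨hi, hj⟩]⟩
  · rintro ⟨h1, h2, h3⟩
    exact ⟨by linarith, fun k => (h1 k).1, fun k => by linarith [(h1 k).2],
      fun k hk => by linarith [h3 k hk.1 hk.2]⟩

end

/-!
The decision boundary is the solution set of one linear equation and finitely many linear
inequalities, and it is compact since it lies in the cube.

*Vertices.* A point of such a set is extreme exactly if it is a basic feasible solution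
(`LinearSystem.extremePoints_feasible`): if the normals of the equation and of the binding
inequalities do not span the space, the point can be moved both ways along a vector orthogonal to
them. A basic feasible solution is determined by the set of inequalities binding there, so there are
finitely many, and by the Krein-Milman theorem every face is the convex hull of those it contains
(`LinearSystem.convexHull_faceVertices`).

*Enumeration.* An edge followed to its end leads to a basic feasible solution, so the recorded set
grows inside a finite set and every run stops. At the end of a run no vertex `v` is missing: take a
linear functional that is minimal only at `v`, and a recorded vertex `s ≠ v` with smallest value.
The section of the cone of feasible directions at `s` by a suitable hyperplane is compact and its
extreme points are edge directions, so the functional decreases along one of them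
(`LinearSystem.IsBasicFeasible.exists_isEdgeDirection_inner_neg`), and the end point of that edge
would be a new vertex with a smaller value.

*Volume from the vertices.* A face that is not a single point is the union of the cones from one
of its vertices `v` over its faces that avoid `v`, since every ray from `v` leaves the face in one
of these, and two such cones meet in a cone over the intersection of their bases. By induction the
simplices cover the face up to finitely many affine subspaces of smaller dimension, and overlap only
in such subspaces. Hence degenerate simplices, and faces of too small a dimension, do no harm, and
the measure of the face is the sum of the measures of the simplices
(`LinearSystem.euclideanHausdorffMeasure_face`). Each simplex is an affine image of a corner of the
cube, so its measure is the square root of a Gram determinant, divided by a factorial.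

*Upper bound.* The boundary lies in the section of the cube by the hyperplane `w ⬝ᵥ x = β`, with
`w = W i - W j` and `β = -b i + b j`, and the bound is the exact area of that section
(`euclideanHausdorffMeasure_cube_hyperplane`). The section is a graph over a slab of the cube of one
dimension less, whose volume is a difference of two volumes of parts of the cube in half-spaces;
these are alternating sums of truncated powers by induction on the dimension
(`volumeReal_cubeHalfSpace`).
-/

/-! ### Vertices of polyhedra -/

section Polyhedra

variable {E : Type*} [NormedAddCommGroup E] [InnerProductSpace ℝ E]

theorem eq_zero_of_inner_eq_zero_of_span_eq_top {s : Set E} (hs : Submodule.span ℝ s = ⊤) {u : E}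
    (h : ∀ a ∈ s, ⟪a, u⟫ = 0) : u = 0 := by
  have : u ∈ (Submodule.span ℝ s)ᗮ := by
    rw [Submodule.mem_orthogonal]
    intro a ha
    induction ha using Submodule.span_induction with
    | mem a ha => exact h a ha
    | zero => simp
    | add a b _ _ ha hb => rw [inner_add_left, ha, hb, add_zero]
    | smul r a _ ha => rw [real_inner_smul_left, ha, mul_zero]
  rwa [hs, Submodule.top_orthogonal_eq_bot, Submodule.mem_bot] at this

theorem span_eq_top_of_forall_inner_eq_zero [FiniteDimensional ℝ E] {s : Set E}
    (h : ∀ u : E, (∀ a ∈ s, ⟪a, u⟫ = 0) → u = 0) : Submodule.span ℝ s = ⊤ := by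
  rw [← Submodule.orthogonal_eq_bot_iff, Submodule.eq_bot_iff]
  exact fun u hu => h u fun a ha => (Submodule.mem_orthogonal _ _).1 hu a (Submodule.subset_span ha)

/-- Finitely many weak linear inequalities that hold at `x` still hold a short way along `u`, in
either direction, if `u` does not decrease the binding ones. -/
theorem eventually_forall_le_inner_add_smul {κ : Type*} [Finite κ] (a : κ → E) (r : κ → ℝ)
    {x u : E} (hx : ∀ c, r c ≤ ⟪a c, x⟫)
    (hu : ∀ c, ⟪a c, x⟫ = r c → 0 ≤ ⟪a c, u⟫) :
    ∀ᶠ ε : ℝ in nhdsWithin 0 (Set.Ioi 0), ∀ c, r c ≤ ⟪a c, x + ε • u⟫ := by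
  rw [Filter.eventually_all]
  intro c
  rcases (hx c).eq_or_lt with h | h
  · filter_upwards [self_mem_nhdsWithin] with ε hε
    rw [inner_add_right, real_inner_smul_right, ← h]
    have := mul_nonneg (le_of_lt (Set.mem_Ioi.1 hε)) (hu c h.symm)
    linarith
  · have : ContinuousAt (fun ε : ℝ => ⟪a c, x + ε • u⟫) 0 := by fun_prop
    have h' := this.eventually_const_lt (u := r c) (by simpa using h)
    exact (h'.filter_mono nhdsWithin_le_nhds).mono fun _ h => h.le

/-- At an extreme point of a polyhedron the normals of the binding inequalities span the space:
otherwise the point could be moved both ways along a vector orthogonal to all of them. -/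
theorem span_binding_eq_top_of_mem_extremePoints [FiniteDimensional ℝ E] {κ : Type*} [Finite κ]
    (a : κ → E) (r : κ → ℝ) {x : E}
    (hx : x ∈ {y | ∀ c, r c ≤ ⟪a c, y⟫}.extremePoints ℝ) :
    Submodule.span ℝ (a '' {c | ⟪a c, x⟫ = r c}) = ⊤ := by
  refine span_eq_top_of_forall_inner_eq_zero fun u hu => ?_
  have hu' : ∀ c, ⟪a c, x⟫ = r c → ⟪a c, u⟫ = 0 := fun c hc => hu _ ⟨c, hc, rfl⟩
  obtain ⟨ε, ⟨h1, h2⟩, hε⟩ := (((eventually_forall_le_inner_add_smul a r (u := u) hx.1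
    fun c hc => (hu' c hc).ge).and (eventually_forall_le_inner_add_smul a r (u := -u) hx.1
    fun c hc => by rw [inner_neg_right, hu' c hc, neg_zero])).and self_mem_nhdsWithin).exists
  have hmem : x ∈ openSegment ℝ (x + ε • u) (x + ε • -u) :=
    ⟨1 / 2, 1 / 2, by norm_num, by norm_num, by norm_num, by module⟩
  have := hx.2 h1 h2 hmem
  simpa [(show (0 : ℝ) < ε from hε).ne'] using this

end Polyhedra

namespace LinearSystem

variable {n : ℕ} {ι : Type} (L : LinearSystem n ι)

/-- The face of the solution set on which all inequalities with a label in `C` are binding. -/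
def face (C : Set ι) : Set (EuclideanSpace ℝ (Fin n)) :=
  {x | L.Feasible x ∧ ∀ c ∈ C, L.Binding c x}

variable {L}

theorem face_empty : L.face ∅ = {x | L.Feasible x} := by simp [face]

theorem face_subset (C : Set ι) : L.face C ⊆ {x | L.Feasible x} := fun _ hx => hx.1

theorem face_mono {C D : Set ι} (h : C ⊆ D) : L.face D ⊆ L.face C :=
  fun _ hx => ⟨hx.1, fun c hc => hx.2 c (h hc)⟩

theorem convex_face (C : Set ι) : Convex ℝ (L.face C) := by
  rintro x ⟨⟨hx, hx'⟩, hxC⟩ y ⟨⟨hy, hy'⟩, hyC⟩ s t hs ht hst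
  refine ⟨⟨?_, fun c => ?_⟩, fun c hc => ?_⟩
  · rw [inner_add_right, real_inner_smul_right, real_inner_smul_right, hx, hy, ← add_mul, hst,
      one_mul]
  · rw [inner_add_right, real_inner_smul_right, real_inner_smul_right]
    calc L.rhs c = s * L.rhs c + t * L.rhs c := by rw [← add_mul, hst, one_mul]
      _ ≤ _ := add_le_add (mul_le_mul_of_nonneg_left (hx' c) hs)
        (mul_le_mul_of_nonneg_left (hy' c) ht)
  · have h1 := hxC c hc
    have h2 := hyC c hc
    unfold Binding at *
    rw [inner_add_right, real_inner_smul_right, real_inner_smul_right, h1, h2, ← add_mul, hst,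
      one_mul]

theorem isClosed_face (C : Set ι) : IsClosed (L.face C) := by
  have : L.face C = {x | ⟪L.eqNormal, x⟫ = L.eqRhs} ∩ (⋂ c, {x | L.rhs c ≤ ⟪L.normal c, x⟫}) ∩
      ⋂ c ∈ C, {x | ⟪L.normal c, x⟫ = L.rhs c} := by
    ext x; simp [face, Feasible, Binding]
  rw [this]
  refine (IsClosed.inter (isClosed_eq (by fun_prop) (by fun_prop))
    (isClosed_iInter fun c => isClosed_le (by fun_prop) (by fun_prop))).inter
    (isClosed_biInter fun c _ => isClosed_eq (by fun_prop) (by fun_prop))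

theorem isCompact_face (hL : IsCompact {x | L.Feasible x}) (C : Set ι) : IsCompact (L.face C) :=
  hL.of_isClosed_subset (isClosed_face C) (face_subset C)

theorem isExtreme_face (C : Set ι) : IsExtreme ℝ {x | L.Feasible x} (L.face C) := by
  refine ⟨face_subset C, ?_⟩
  rintro x hx y hy z ⟨hz, hzC⟩ ⟨s, t, hs, ht, hst, rfl⟩
  refine ⟨hx, fun c hc => ?_⟩
  have h := hzC c hc
  have h1 := hx.2 c
  have h2 := hy.2 c
  unfold Binding at *
  rw [inner_add_right, real_inner_smul_right, real_inner_smul_right] at h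
  have hr : L.rhs c = s * L.rhs c + t * L.rhs c := by rw [← add_mul, hst, one_mul]
  by_contra hne
  have h3 := mul_lt_mul_of_pos_left (lt_of_le_of_ne h1 (Ne.symm hne)) hs
  have h4 := mul_le_mul_of_nonneg_left h2 ht.le
  linarith

/-- A feasible point that is binding wherever the basic feasible solution `s` is equals `s`. -/
theorem IsBasicFeasible.eq_of_binding {s x : EuclideanSpace ℝ (Fin n)} (hs : L.IsBasicFeasible s)
    (hx : L.Feasible x) (h : ∀ c, L.Binding c s → L.Binding c x) : x = s := by
  refine sub_eq_zero.1 (eq_zero_of_inner_eq_zero_of_span_eq_top hs.2 ?_)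
  rintro _ (rfl | ⟨c, hc, rfl⟩)
  · rw [inner_sub_right, hx.1, hs.1.1, sub_self]
  · rw [inner_sub_right, h c hc, hc, sub_self]

variable [Finite ι]

theorem extremePoints_feasible :
    {x | L.Feasible x}.extremePoints ℝ = {x | L.IsBasicFeasible x} := by
  ext x
  constructor
  · intro hx
    refine ⟨hx.1, ?_⟩
    -- the equation is written as two opposite inequalities
    let a : Bool ⊕ ι → EuclideanSpace ℝ (Fin n) :=
      Sum.elim (fun σ => if σ then L.eqNormal else -L.eqNormal) L.normal
    let r : Bool ⊕ ι → ℝ := Sum.elim (fun σ => if σ then L.eqRhs else -L.eqRhs) L.rhs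
    have hP : {x | L.Feasible x} = {y | ∀ c, r c ≤ ⟪a c, y⟫} := by
      ext y
      simp only [Feasible, Set.mem_ofPred_eq, Sum.forall, a, r, Sum.elim_inl, Sum.elim_inr,
        Bool.forall_bool, inner_neg_left, neg_le_neg_iff, if_true, Bool.false_eq_true, if_false]
      rw [le_antisymm_iff (a := ⟪L.eqNormal, y⟫)]
    rw [hP] at hx
    rw [eq_top_iff, ← span_binding_eq_top_of_mem_extremePoints a r hx, Submodule.span_le]
    rintro _ ⟨(σ | c), hc, rfl⟩
    · have := Submodule.subset_span (R := ℝ)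
        (Set.mem_insert L.eqNormal (L.normal '' {c | L.Binding c x}))
      cases σ
      · simpa [a] using this
      · simpa [a] using this
    · exact Submodule.subset_span (Set.mem_insert_of_mem _ ⟨c, hc, rfl⟩)
  · intro hx
    refine ⟨hx.1, fun y hy z hz hxyz => hx.eq_of_binding hy fun c hc => ?_⟩
    exact ((isExtreme_face {c}).2 hy hz ⟨hx.1, by simpa using hc⟩ hxyz).2 c rfl

theorem finite_isBasicFeasible : {x | L.IsBasicFeasible x}.Finite := by
  refine Set.Finite.of_finite_image (f := fun x => {c | L.Binding c x}) (Set.toFinite _) ?_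
  intro x hx y hy hxy
  refine hy.eq_of_binding hx.1 fun c hc => ?_
  exact (Set.ext_iff.1 hxy c).2 hc

variable (L) in
/-- The basic feasible solutions on a face, as a finite set. -/
noncomputable def faceVertices (C : Set ι) : Finset (EuclideanSpace ℝ (Fin n)) :=
  finite_isBasicFeasible (L := L) |>.toFinset.filter fun x => ∀ c ∈ C, L.Binding c x

theorem mem_faceVertices {C : Set ι} {x : EuclideanSpace ℝ (Fin n)} :
    x ∈ L.faceVertices C ↔ L.IsBasicFeasible x ∧ ∀ c ∈ C, L.Binding c x := by
  simp [faceVertices]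

theorem faceVertices_subset_face (C : Set ι) : (L.faceVertices C : Set _) ⊆ L.face C :=
  fun _ hx => ⟨(mem_faceVertices.1 hx).1.1, (mem_faceVertices.1 hx).2⟩

theorem extremePoints_face (C : Set ι) : (L.face C).extremePoints ℝ = L.faceVertices C := by
  rw [(isExtreme_face C).extremePoints_eq, extremePoints_feasible]
  ext x
  simp only [Set.mem_inter_iff, Finset.mem_coe, mem_faceVertices]
  exact ⟨fun h => ⟨h.2, h.1.2⟩, fun h => ⟨⟨h.1.1, h.2⟩, h.1⟩⟩

theorem convexHull_faceVertices (hL : IsCompact {x | L.Feasible x}) (C : Set ι) :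
    convexHull ℝ (L.faceVertices C : Set _) = L.face C := by
  rw [← closure_convexHull_extremePoints (isCompact_face hL C) (convex_face C),
    extremePoints_face, (Finset.finite_toSet _).isClosed_convexHull ℝ |>.closure_eq]

end LinearSystem

/-! ### Edges and the enumeration of the vertices -/

namespace LinearSystem

variable {n : ℕ} {ι : Type} {L : LinearSystem n ι}

variable (L) in
/-- The sum of the normals of the inequalities that are binding at `s`. The linear functional it
defines attains its minimum over the solution set at `s`, and only there if `s` is basic. -/
noncomputable def bindingSum [Fintype ι] (s : EuclideanSpace ℝ (Fin n)) :
    EuclideanSpace ℝ (Fin n) :=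
  ∑ c with L.Binding c s, L.normal c

theorem inner_bindingSum [Fintype ι] (s u : EuclideanSpace ℝ (Fin n)) :
    ⟪L.bindingSum s, u⟫ = ∑ c with L.Binding c s, ⟪L.normal c, u⟫ := by
  rw [bindingSum, sum_inner]

theorem IsBasicFeasible.inner_bindingSum_pos [Fintype ι] {s u : EuclideanSpace ℝ (Fin n)}
    (hs : L.IsBasicFeasible s) (hu : u ≠ 0) (he : ⟪L.eqNormal, u⟫ = 0)
    (hc : ∀ c, L.Binding c s → 0 ≤ ⟪L.normal c, u⟫) : 0 < ⟪L.bindingSum s, u⟫ := by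
  rw [inner_bindingSum]
  have hnn : ∀ c ∈ Finset.univ.filter (fun c => L.Binding c s), 0 ≤ ⟪L.normal c, u⟫ :=
    fun c h => hc c (Finset.mem_filter.1 h).2
  refine (Finset.sum_nonneg hnn).lt_of_ne fun h => hu ?_
  have h0 := (Finset.sum_eq_zero_iff_of_nonneg hnn).1 h.symm
  refine eq_zero_of_inner_eq_zero_of_span_eq_top hs.2 ?_
  rintro _ (rfl | ⟨c, hcs, rfl⟩)
  · exact he
  · exact h0 c (Finset.mem_filter.2 ⟨Finset.mem_univ _, hcs⟩)

theorem inner_eqNormal_sub {s x : EuclideanSpace ℝ (Fin n)} (hs : L.Feasible s)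
    (hx : L.Feasible x) : ⟪L.eqNormal, x - s⟫ = 0 := by
  rw [inner_sub_right, hx.1, hs.1, sub_self]

theorem inner_normal_sub_nonneg {s x : EuclideanSpace ℝ (Fin n)} (hx : L.Feasible x) {c : ι}
    (hc : L.Binding c s) : 0 ≤ ⟪L.normal c, x - s⟫ := by
  rw [inner_sub_right, show ⟪L.normal c, s⟫ = L.rhs c from hc]
  linarith [hx.2 c]

variable (L) in
/-- The section `⟪bindingSum s, d⟫ = 1` of the cone of feasible directions at `s`. -/
def directionSection [Fintype ι] (s : EuclideanSpace ℝ (Fin n)) :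
    Set (EuclideanSpace ℝ (Fin n)) :=
  {d | ⟪L.eqNormal, d⟫ = 0 ∧ ⟪L.bindingSum s, d⟫ = 1 ∧ ∀ c, L.Binding c s → 0 ≤ ⟪L.normal c, d⟫}

theorem convex_directionSection [Fintype ι] (s : EuclideanSpace ℝ (Fin n)) :
    Convex ℝ (L.directionSection s) := by
  rintro x ⟨h1, h2, h3⟩ y ⟨k1, k2, k3⟩ p q hp hq hpq
  refine ⟨?_, ?_, fun c hc => ?_⟩ <;>
    rw [inner_add_right, real_inner_smul_right, real_inner_smul_right]
  · rw [h1, k1]; ring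
  · rw [h2, k2]; linarith
  · exact add_nonneg (mul_nonneg hp (h3 c hc)) (mul_nonneg hq (k3 c hc))

theorem IsBasicFeasible.isCompact_directionSection [Fintype ι] {s : EuclideanSpace ℝ (Fin n)}
    (hs : L.IsBasicFeasible s) : IsCompact (L.directionSection s) := by
  have hclosed : IsClosed (L.directionSection s) := by
    have : L.directionSection s = ({d | ⟪L.eqNormal, d⟫ = 0} ∩ {d | ⟪L.bindingSum s, d⟫ = 1}) ∩
        ⋂ c, ⋂ (_ : L.Binding c s), {d | 0 ≤ ⟪L.normal c, d⟫} := by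
      ext d; simp [directionSection, and_assoc]
    rw [this]
    exact ((isClosed_eq (by fun_prop) (by fun_prop)).inter
      (isClosed_eq (by fun_prop) (by fun_prop))).inter
      (isClosed_iInter fun c => isClosed_iInter fun _ => isClosed_le (by fun_prop) (by fun_prop))
  refine Metric.isCompact_of_isClosed_isBounded hclosed ?_
  -- the normals span, so a vector is controlled by its products with them, and these are bounded
  let f : EuclideanSpace ℝ (Fin n) →ₗ[ℝ] ℝ × ({c // L.Binding c s} → ℝ) :=
    (innerₛₗ ℝ L.eqNormal).prod (LinearMap.pi fun c => innerₛₗ ℝ (L.normal c.1))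
  have hf : f.ker = ⊥ := by
    rw [LinearMap.ker_eq_bot']
    intro u hu
    have h1 : ⟪L.eqNormal, u⟫ = 0 := congrArg Prod.fst hu
    have h2 : ∀ c : {c // L.Binding c s}, ⟪L.normal c.1, u⟫ = 0 :=
      fun c => congrFun (congrArg Prod.snd hu) c
    refine eq_zero_of_inner_eq_zero_of_span_eq_top hs.2 ?_
    rintro _ (rfl | ⟨c, hc, rfl⟩)
    exacts [h1, h2 ⟨c, hc⟩]
  obtain ⟨K, -, hK⟩ := f.exists_antilipschitzWith hf
  refine (hK.isBounded_preimage (Metric.isBounded_closedBall (x := 0) (r := 1))).subset ?_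
  rintro d ⟨h1, h2, h3⟩
  rw [Set.mem_preimage, mem_closedBall_zero_iff, Prod.norm_def, sup_le_iff,
    pi_norm_le_iff_of_nonneg zero_le_one]
  rw [inner_bindingSum] at h2
  refine ⟨?_, fun c => ?_⟩
  · change ‖⟪L.eqNormal, d⟫‖ ≤ 1
    simp [h1]
  · change ‖⟪L.normal c.1, d⟫‖ ≤ 1
    rw [Real.norm_eq_abs, abs_of_nonneg (h3 _ c.2), ← h2]
    exact Finset.single_le_sum (f := fun c => ⟪L.normal c, d⟫)
      (fun c h => h3 c (Finset.mem_filter.1 h).2) (by simpa using c.2)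

theorem isEdgeDirection_of_mem_extremePoints [Fintype ι] {s d : EuclideanSpace ℝ (Fin n)}
    (hd : d ∈ (L.directionSection s).extremePoints ℝ) : L.IsEdgeDirection s d := by
  obtain ⟨h1, h2, h3⟩ := hd.1
  have hd0 : d ≠ 0 := by rintro rfl; simp at h2
  refine ⟨hd0, h1, h3, ?_⟩
  set U := Submodule.span ℝ
    (insert L.eqNormal (L.normal '' {c | L.Binding c s ∧ ⟪L.normal c, d⟫ = 0})) with hU
  let a : Bool ⊕ Bool ⊕ {c // L.Binding c s} → EuclideanSpace ℝ (Fin n) :=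
    Sum.elim (fun σ => if σ then L.eqNormal else -L.eqNormal)
      (Sum.elim (fun σ => if σ then L.bindingSum s else -L.bindingSum s) fun c => L.normal c.1)
  let r : Bool ⊕ Bool ⊕ {c // L.Binding c s} → ℝ :=
    Sum.elim (fun _ => 0) (Sum.elim (fun σ => if σ then 1 else -1) fun _ => 0)
  have hP : L.directionSection s = {y | ∀ c, r c ≤ ⟪a c, y⟫} := by
    ext y
    simp only [directionSection, Set.mem_ofPred_eq, Sum.forall, a, r, Sum.elim_inl, Sum.elim_inr,
      Bool.forall_bool, inner_neg_left, neg_le_neg_iff, if_true, Bool.false_eq_true, if_false,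
      Subtype.forall, Left.nonneg_neg_iff]
    rw [le_antisymm_iff (a := ⟪L.eqNormal, y⟫), le_antisymm_iff (a := ⟪L.bindingSum s, y⟫)]
  have htop : U ⊔ Submodule.span ℝ {L.bindingSum s} = ⊤ := by
    rw [hP] at hd
    rw [eq_top_iff, ← span_binding_eq_top_of_mem_extremePoints a r hd, Submodule.span_le]
    have he : L.eqNormal ∈ U := Submodule.subset_span (Set.mem_insert _ _)
    have hb : L.bindingSum s ∈ Submodule.span ℝ {L.bindingSum s} :=
      Submodule.mem_span_singleton_self _
    rintro _ ⟨(σ | σ | c), hc, rfl⟩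
    · apply Submodule.mem_sup_left
      cases σ <;> simpa [a] using he
    · apply Submodule.mem_sup_right
      cases σ
      · simpa only [a, Sum.elim_inr, Sum.elim_inl, Bool.false_eq_true, if_false] using neg_mem hb
      · exact hb
    · exact Submodule.mem_sup_left (Submodule.subset_span
        (Set.mem_insert_of_mem _ ⟨c.1, ⟨c.2, hc⟩, rfl⟩))
  have hge : n ≤ Module.finrank ℝ U + 1 := by
    have h := Submodule.finrank_add_le_finrank_add_finrank U
      (Submodule.span ℝ {L.bindingSum s})
    rw [htop, finrank_top, finrank_euclideanSpace_fin] at h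
    exact h.trans (Nat.add_le_add_left ((finrank_span_le_card _).trans (by simp)) _)
  have hle : U ≤ (Submodule.span ℝ {d})ᗮ := by
    rw [hU, Submodule.span_le]
    rintro _ (rfl | ⟨c, hc, rfl⟩)
    · exact Submodule.mem_orthogonal_singleton_iff_inner_left.2 h1
    · exact Submodule.mem_orthogonal_singleton_iff_inner_left.2 hc.2
  have h4 := Submodule.finrank_mono hle
  have h5 := (Submodule.span ℝ {d}).finrank_add_finrank_orthogonal
  rw [finrank_span_singleton hd0, finrank_euclideanSpace_fin] at h5
  omega

/-- If a linear functional is not minimal over the solution set at the basic feasible solution `s`,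
then it decreases along some edge direction at `s`. -/
theorem IsBasicFeasible.exists_isEdgeDirection_inner_neg [Fintype ι]
    {s x f : EuclideanSpace ℝ (Fin n)} (hs : L.IsBasicFeasible s) (hx : L.Feasible x)
    (hf : ⟪f, x - s⟫ < 0) : ∃ d, L.IsEdgeDirection s d ∧ ⟪f, d⟫ < 0 := by
  by_contra! hcon
  have hsub : L.directionSection s ⊆ {d | 0 ≤ ⟪f, d⟫} := by
    rw [← closure_convexHull_extremePoints hs.isCompact_directionSection
      (convex_directionSection s)]
    refine closure_minimal (convexHull_min
      (fun d hd => hcon d (isEdgeDirection_of_mem_extremePoints hd)) ?_)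
      (isClosed_le (by fun_prop) (by fun_prop))
    exact (convex_Ici 0).is_linear_preimage (innerₛₗ ℝ f).isLinear
  have hne : x - s ≠ 0 := by intro h; simp [h] at hf
  have hpos := hs.inner_bindingSum_pos hne (inner_eqNormal_sub hs.1 hx)
    fun c => inner_normal_sub_nonneg hx
  have hmem : (⟪L.bindingSum s, x - s⟫)⁻¹ • (x - s) ∈ L.directionSection s := by
    refine ⟨?_, ?_, fun c hc => ?_⟩ <;> rw [real_inner_smul_right]
    · rw [inner_eqNormal_sub hs.1 hx, mul_zero]
    · exact inv_mul_cancel₀ hpos.ne'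
    · exact mul_nonneg (inv_nonneg.2 hpos.le) (inner_normal_sub_nonneg hx hc)
  have h := hsub hmem
  rw [Set.mem_ofPred_eq, real_inner_smul_right] at h
  exact (mul_neg_of_pos_of_neg (inv_pos.2 hpos) hf).not_ge h

theorem eventually_feasible_add_smul [Finite ι] {s d : EuclideanSpace ℝ (Fin n)}
    (hs : L.Feasible s) (he : ⟪L.eqNormal, d⟫ = 0)
    (hd : ∀ c, L.Binding c s → 0 ≤ ⟪L.normal c, d⟫) :
    ∀ᶠ ε : ℝ in nhdsWithin 0 (Set.Ioi 0), L.Feasible (s + ε • d) := by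
  filter_upwards [eventually_forall_le_inner_add_smul L.normal L.rhs hs.2 hd] with ε hε
  exact ⟨by rw [inner_add_right, real_inner_smul_right, he, mul_zero, add_zero, hs.1], hε⟩

theorem exists_isGreatest_feasible (hL : IsCompact {x | L.Feasible x})
    {s d : EuclideanSpace ℝ (Fin n)} (hs : L.Feasible s) (hd : d ≠ 0) :
    ∃ t, IsGreatest {t : ℝ | L.Feasible (s + t • d)} t := by
  have hclosed : IsClosed {t : ℝ | L.Feasible (s + t • d)} :=
    hL.isClosed.preimage (f := fun t : ℝ => s + t • d) (by fun_prop)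
  obtain ⟨R, hR⟩ := hL.isBounded.exists_norm_le
  refine (Metric.isCompact_of_isClosed_isBounded hclosed ?_).exists_isGreatest ⟨0, by simpa⟩
  refine isBounded_iff_forall_norm_le.2 ⟨(R + ‖s‖) / ‖d‖, fun t ht => ?_⟩
  rw [le_div_iff₀ (norm_pos_iff.2 hd), ← norm_smul]
  calc ‖t • d‖ = ‖(s + t • d) - s‖ := by rw [add_sub_cancel_left]
    _ ≤ ‖s + t • d‖ + ‖s‖ := norm_sub_le _ _
    _ ≤ R + ‖s‖ := by gcongr; exact hR _ ht

/-- At the end of a maximal feasible move along `d` some inequality has become binding whose normal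
has negative inner product with `d`. -/
theorem exists_binding_of_isGreatest [Finite ι] {s d : EuclideanSpace ℝ (Fin n)}
    (he : ⟪L.eqNormal, d⟫ = 0) {t : ℝ} (ht : IsGreatest {t : ℝ | L.Feasible (s + t • d)} t) :
    ∃ c, L.Binding c (s + t • d) ∧ ⟪L.normal c, d⟫ < 0 := by
  by_contra! hcon
  obtain ⟨ε, h1, h2⟩ :=
    ((eventually_feasible_add_smul ht.1 he hcon).and self_mem_nhdsWithin).exists
  rw [add_assoc, ← add_smul] at h1
  have := ht.2 h1
  have h3 : (0 : ℝ) < ε := h2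
  linarith

/-- The end point of an edge is a basic feasible solution: the inequality that stops the move is
independent of those that stay binding along the edge. -/
theorem IsEdgeDirection.isBasicFeasible_of_isGreatest [Finite ι] {s d : EuclideanSpace ℝ (Fin n)}
    (hd : L.IsEdgeDirection s d) {t : ℝ}
    (ht : IsGreatest {t : ℝ | L.Feasible (s + t • d)} t) : L.IsBasicFeasible (s + t • d) := by
  refine ⟨ht.1, ?_⟩
  obtain ⟨c, hc, hcd⟩ := exists_binding_of_isGreatest hd.2.1 ht
  obtain ⟨hd0, he, -, hrank⟩ := hd
  set U := Submodule.span ℝ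
    (insert L.eqNormal (L.normal '' {c | L.Binding c s ∧ ⟪L.normal c, d⟫ = 0})) with hU
  set V := Submodule.span ℝ
    (insert L.eqNormal (L.normal '' {c | L.Binding c (s + t • d)})) with hV
  have hUd : U ≤ (Submodule.span ℝ {d})ᗮ := by
    rw [hU, Submodule.span_le]
    rintro _ (rfl | ⟨c, hc, rfl⟩)
    · exact Submodule.mem_orthogonal_singleton_iff_inner_left.2 he
    · exact Submodule.mem_orthogonal_singleton_iff_inner_left.2 hc.2
  have hUV : U < V := by
    refine lt_of_le_of_ne (Submodule.span_mono (Set.insert_subset_insert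
      (Set.image_mono fun c hc => ?_))) fun h => ?_
    · change ⟪L.normal c, s + t • d⟫ = L.rhs c
      rw [inner_add_right, real_inner_smul_right, hc.2, mul_zero, add_zero]
      exact hc.1
    · have : L.normal c ∈ U := h ▸ Submodule.subset_span (Set.mem_insert_of_mem _ ⟨c, hc, rfl⟩)
      exact hcd.ne (Submodule.mem_orthogonal_singleton_iff_inner_left.1 (hUd this))
  refine Submodule.eq_top_of_finrank_eq (le_antisymm (Submodule.finrank_le _) ?_)
  rw [finrank_euclideanSpace_fin]
  have := Submodule.finrank_lt_finrank_of_lt hUV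
  omega

theorem Start.isBasicFeasible {S : Finset (EuclideanSpace ℝ (Fin n))} (hS : L.Start S) :
    ∀ s ∈ S, L.IsBasicFeasible s := by
  rcases hS with ⟨s, hs, rfl⟩ | ⟨-, rfl⟩
  · simpa using hs
  · simp

theorem Step.isBasicFeasible [Finite ι] {S S' : Finset (EuclideanSpace ℝ (Fin n))}
    (h : L.Step S S') (hS : ∀ s ∈ S, L.IsBasicFeasible s) : ∀ s ∈ S', L.IsBasicFeasible s := by
  obtain ⟨s, hs, d, hd, t, ht, -, rfl⟩ := h
  intro x hx
  rcases Finset.mem_insert.1 hx with rfl | hx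
  exacts [hd.isBasicFeasible_of_isGreatest ht, hS x hx]

theorem Step.subset {S S' : Finset (EuclideanSpace ℝ (Fin n))} (h : L.Step S S') : S ⊆ S' := by
  obtain ⟨s, hs, d, hd, t, ht, -, rfl⟩ := h
  exact Finset.subset_insert _ _

theorem Step.card {S S' : Finset (EuclideanSpace ℝ (Fin n))} (h : L.Step S S') :
    S'.card = S.card + 1 := by
  obtain ⟨s, hs, d, hd, t, ht, hnot, rfl⟩ := h
  exact Finset.card_insert_of_notMem hnot

theorem card_le_of_forall_isBasicFeasible [Finite ι] {S : Finset (EuclideanSpace ℝ (Fin n))}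
    (hS : ∀ s ∈ S, L.IsBasicFeasible s) : S.card ≤ (L.faceVertices ∅).card :=
  Finset.card_le_card fun s hs => mem_faceVertices.2 ⟨hS s hs, by simp⟩

theorem not_exists_infinite_run [Finite ι] :
    ¬ ∃ S : ℕ → Finset (EuclideanSpace ℝ (Fin n)),
      L.Start (S 0) ∧ ∀ t, L.Step (S t) (S (t + 1)) := by
  rintro ⟨S, h0, hS⟩
  have hB : ∀ t, ∀ s ∈ S t, L.IsBasicFeasible s := by
    intro t
    induction t with
    | zero => exact h0.isBasicFeasible
    | succ t ih => exact (hS t).isBasicFeasible ih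
  have hcard : ∀ t, t ≤ (S t).card := by
    intro t
    induction t with
    | zero => exact Nat.zero_le _
    | succ t ih => rw [(hS t).card]; omega
  have h1 := hcard ((L.faceVertices ∅).card + 1)
  have h2 := card_le_of_forall_isBasicFeasible (hB ((L.faceVertices ∅).card + 1))
  omega

variable (L) in
theorem exists_start : ∃ S, L.Start S := by
  by_cases h : ∃ s, L.IsBasicFeasible s
  · obtain ⟨s, hs⟩ := h
    exact ⟨{s}, Or.inl ⟨s, hs, rfl⟩⟩
  · exact ⟨∅, Or.inr ⟨not_exists.1 h, rfl⟩⟩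

variable (L) in
theorem exists_isOutput [Finite ι] : ∃ S, L.IsOutput S := by
  by_contra! hcon
  obtain ⟨S₀, h0⟩ := L.exists_start
  have hnext : ∀ S, Relation.ReflTransGen L.Step S₀ S → ∃ S', L.Step S S' := fun S hS => by
    by_contra! h
    exact hcon S ⟨S₀, h0, hS, h⟩
  choose! next hnext using hnext
  have hreach : ∀ t, Relation.ReflTransGen L.Step S₀ (next^[t] S₀) := by
    intro t
    induction t with
    | zero => exact .refl
    | succ t ih => rw [Function.iterate_succ_apply']; exact ih.tail (hnext _ ih)
  refine not_exists_infinite_run (L := L) ⟨fun t => next^[t] S₀, h0, fun t => ?_⟩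
  simp only [Function.iterate_succ_apply']
  exact hnext _ (hreach t)

/-- A nonempty set of vertices that is closed under following edges contains all vertices. For a
vertex `v`, the functional that is minimal only at `v` is minimized over the set at some `s`; if
`s ≠ v`, it decreases along an edge at `s`, whose end point is again in the set. -/
theorem mem_of_forall_not_step [Fintype ι] (hL : IsCompact {x | L.Feasible x})
    {S : Finset (EuclideanSpace ℝ (Fin n))} (hne : S.Nonempty)
    (hS : ∀ s ∈ S, L.IsBasicFeasible s) (hstep : ∀ S', ¬ L.Step S S')
    {v : EuclideanSpace ℝ (Fin n)} (hv : L.IsBasicFeasible v) : v ∈ S := by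
  obtain ⟨s, hs, hmin⟩ := S.exists_min_image (fun x => ⟪L.bindingSum v, x⟫) hne
  by_contra hvS
  have hsv : s - v ≠ 0 := sub_ne_zero.2 fun h => hvS (h ▸ hs)
  have hpos := hv.inner_bindingSum_pos hsv (inner_eqNormal_sub hv.1 (hS s hs).1)
    fun c => inner_normal_sub_nonneg (hS s hs).1
  obtain ⟨d, hd, hneg⟩ := (hS s hs).exists_isEdgeDirection_inner_neg hv.1
    (f := L.bindingSum v) (by rw [← neg_sub, inner_neg_right]; linarith)
  obtain ⟨t, ht⟩ := exists_isGreatest_feasible hL (hS s hs).1 hd.1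
  have htpos : 0 < t := by
    obtain ⟨ε, h1, h2⟩ := ((eventually_feasible_add_smul (hS s hs).1 hd.2.1 hd.2.2.1).and
      self_mem_nhdsWithin).exists
    exact lt_of_lt_of_le (show (0 : ℝ) < ε from h2) (ht.2 h1)
  have hnew : s + t • d ∉ S := fun h => by
    have := hmin _ h
    rw [inner_add_right, real_inner_smul_right] at this
    have := mul_neg_of_pos_of_neg htpos hneg
    linarith
  exact hstep _ ⟨s, hs, d, hd, t, ht, hnew, rfl⟩

theorem IsOutput.eq_faceVertices [Fintype ι] (hL : IsCompact {x | L.Feasible x})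
    {S : Finset (EuclideanSpace ℝ (Fin n))} (hS : L.IsOutput S) : S = L.faceVertices ∅ := by
  obtain ⟨S₀, h0, hrun, hfinal⟩ := hS
  have hB : (∀ s ∈ S, L.IsBasicFeasible s) ∧ S₀ ⊆ S := by
    clear hfinal
    induction hrun with
    | refl => exact ⟨h0.isBasicFeasible, subset_rfl⟩
    | tail _ h ih => exact ⟨h.isBasicFeasible ih.1, ih.2.trans h.subset⟩
  ext v
  simp only [mem_faceVertices, Set.mem_empty_iff_false, false_imp_iff, implies_true, and_true]
  refine ⟨hB.1 v, fun hv => ?_⟩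
  refine mem_of_forall_not_step hL ?_ hB.1 hfinal hv
  rcases h0 with ⟨s, -, rfl⟩ | ⟨h, -⟩
  exacts [⟨s, hB.2 (Finset.mem_singleton_self s)⟩, absurd hv (h v)]

end LinearSystem

/-! ### Volumes of half-space sections of the cube -/

section CubeSections

/-- The truncated power `x ↦ x₊ ^ e`, with the convention `0₊ ^ 0 = 1`. For `e = 0` it is the
indicator function of `[0, ∞)`. -/
noncomputable def truncPow (e : ℕ) (x : ℝ) : ℝ := if 0 ≤ x then x ^ e else 0

theorem truncPow_eq_max {e : ℕ} (he : e ≠ 0) (x : ℝ) : truncPow e x = max 0 x ^ e := by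
  unfold truncPow
  split_ifs with h
  · rw [max_eq_right h]
  · rw [max_eq_left (not_le.1 h).le, zero_pow he]

theorem monotone_truncPow (e : ℕ) : Monotone (truncPow e) := by
  intro x y hxy
  unfold truncPow
  split_ifs with h1 h2 h2
  · gcongr
  · exact absurd (h1.trans hxy) h2
  · positivity
  · rfl

theorem integral_truncPow (e : ℕ) (a b : ℝ) :
    ∫ x in a..b, truncPow e x = (truncPow (e + 1) b - truncPow (e + 1) a) / (e + 1) := by
  have hint : ∀ a b, IntervalIntegrable (truncPow e) volume a b :=
    fun a b => (monotone_truncPow e).intervalIntegrable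
  have h0 : ∀ b, ∫ x in (0 : ℝ)..b, truncPow e x = truncPow (e + 1) b / (e + 1) := by
    intro b
    rcases le_or_gt 0 b with hb | hb
    · rw [truncPow, if_pos hb, intervalIntegral.integral_congr (g := fun x => x ^ e),
        integral_pow, zero_pow (Nat.succ_ne_zero _), sub_zero]
      intro x hx
      rw [Set.uIcc_of_le hb] at hx
      exact if_pos hx.1
    · rw [truncPow, if_neg hb.not_ge, zero_div]
      refine intervalIntegral.integral_zero_ae ?_
      filter_upwards [Measure.ae_ne volume (0 : ℝ)] with x hx0 hx
      rw [Set.uIoc_of_ge hb.le] at hx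
      exact if_neg (lt_of_le_of_ne hx.2 hx0).not_ge
  rw [← intervalIntegral.integral_interval_sub_left (hint 0 b) (hint 0 a), h0, h0, sub_div]

/-- A sum over the subsets of `Fin (k + 1)`, split into those without `0` and those with `0`. -/
theorem sum_finset_fin_succ {M : Type*} [AddCommMonoid M] {k : ℕ} (f : Finset (Fin (k + 1)) → M) :
    ∑ K, f K = ∑ K : Finset (Fin k), f (K.map (Fin.succEmb k)) +
      ∑ K : Finset (Fin k), f (insert 0 (K.map (Fin.succEmb k))) := by
  have h0 : (0 : Fin (k + 1)) ∉ (Finset.univ : Finset (Fin k)).image (Fin.succEmb k) := by simp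
  have hu : (Finset.univ : Finset (Fin (k + 1))) =
      insert 0 ((Finset.univ : Finset (Fin k)).image (Fin.succEmb k)) := by
    ext i; cases i using Fin.cases <;> simp
  have hinj : Function.Injective fun K : Finset (Fin k) => K.image (Fin.succEmb k) :=
    Finset.image_injective (Fin.succEmb k).injective
  rw [← Finset.powerset_univ, hu, Finset.sum_powerset_insert h0, Finset.powerset_image,
    Finset.sum_image hinj.injOn, Finset.sum_image hinj.injOn, Finset.powerset_univ]
  simp only [Finset.map_eq_image]

/-- The alternating sum of truncated powers at the values of `t - w ⬝ᵥ x` at the vertices `x` of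
the cube. -/
noncomputable def alternatingSum (e : ℕ) {k : ℕ} (w : Fin k → ℝ) (t : ℝ) : ℝ :=
  ∑ K : Finset (Fin k), (-1 : ℝ) ^ K.card * truncPow e (t - ∑ i ∈ K, w i)

theorem alternatingSum_zero (e : ℕ) (w : Fin 0 → ℝ) (t : ℝ) :
    alternatingSum e w t = truncPow e t := by
  simp [alternatingSum, Finset.eq_empty_of_isEmpty]

theorem alternatingSum_succ (e : ℕ) {k : ℕ} (w : Fin (k + 1) → ℝ) (t : ℝ) :
    alternatingSum e w t =
      alternatingSum e (Fin.tail w) t - alternatingSum e (Fin.tail w) (t - w 0) := by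
  unfold alternatingSum
  rw [sum_finset_fin_succ, sub_eq_add_neg, ← Finset.sum_neg_distrib]
  have h0 : ∀ K : Finset (Fin k), (0 : Fin (k + 1)) ∉ K.map (Fin.succEmb k) := by simp
  congr 1
  · simp [Fin.tail]
  · refine Finset.sum_congr rfl fun K _ => ?_
    rw [Finset.card_insert_of_notMem (h0 K), Finset.sum_insert (h0 K), Finset.card_map,
      Finset.sum_map, pow_succ, ← sub_sub]
    simp [Fin.tail]

theorem integral_alternatingSum (e : ℕ) {k : ℕ} (w : Fin k → ℝ) (t : ℝ) {c : ℝ} (hc : c ≠ 0) :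
    ∫ s in (0 : ℝ)..1, alternatingSum e w (t - c * s) =
      (alternatingSum (e + 1) w t - alternatingSum (e + 1) w (t - c)) / ((e + 1) * c) := by
  have hint : ∀ a : ℝ, IntervalIntegrable (fun s => truncPow e (a - c * s)) volume 0 1 := by
    intro a
    rcases le_total 0 c with h | h
    · have : Antitone fun s => truncPow e (a - c * s) := fun x y hxy =>
        monotone_truncPow e (sub_le_sub_left (mul_le_mul_of_nonneg_left hxy h) a)
      exact this.intervalIntegrable
    · have : Monotone fun s => truncPow e (a - c * s) := fun x y hxy =>
        monotone_truncPow e (sub_le_sub_left (mul_le_mul_of_nonpos_left hxy h) a)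
      exact this.intervalIntegrable
  unfold alternatingSum
  have hcomm : ∀ s : ℝ, ∀ K : Finset (Fin k),
      t - c * s - ∑ i ∈ K, w i = (t - ∑ i ∈ K, w i) - c * s := fun s K => by ring
  simp only [hcomm]
  rw [intervalIntegral.integral_finsetSum fun K _ => (hint _).const_mul _, ← Finset.sum_sub_distrib,
    Finset.sum_div]
  refine Finset.sum_congr rfl fun K _ => ?_
  rw [intervalIntegral.integral_const_mul, intervalIntegral.integral_comp_sub_mul _ hc,
    integral_truncPow, smul_eq_mul, mul_zero, mul_one, sub_zero,
    show t - c - ∑ i ∈ K, w i = t - ∑ i ∈ K, w i - c by ring]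
  have : (e + 1 : ℝ) ≠ 0 := by positivity
  field_simp

/-- The part of the cube `[0,1]^k` in the half-space `w ⬝ᵥ y ≤ t`. -/
def cubeHalfSpace {k : ℕ} (w : Fin k → ℝ) (t : ℝ) : Set (Fin k → ℝ) :=
  {y | (∀ i, 0 ≤ y i ∧ y i ≤ 1) ∧ ∑ i, w i * y i ≤ t}

theorem isClosed_cubeHalfSpace {k : ℕ} (w : Fin k → ℝ) (t : ℝ) :
    IsClosed (cubeHalfSpace w t) := by
  have : cubeHalfSpace w t = (⋂ i, ({y | 0 ≤ y i} ∩ {y | y i ≤ 1})) ∩ {y | ∑ i, w i * y i ≤ t} := by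
    ext y; simp [cubeHalfSpace]
  rw [this]
  exact (isClosed_iInter fun i => (isClosed_le (by fun_prop) (by fun_prop)).inter
    (isClosed_le (by fun_prop) (by fun_prop))).inter (isClosed_le (by fun_prop) (by fun_prop))

theorem volume_cubeHalfSpace_lt_top {k : ℕ} (w : Fin k → ℝ) (t : ℝ) :
    volume (cubeHalfSpace w t) < ⊤ := by
  refine (measure_mono (fun y hy => ?_)).trans_lt
    (isCompact_Icc (a := (0 : Fin k → ℝ)) (b := 1)).measure_lt_top
  exact ⟨fun i => (hy.1 i).1, fun i => (hy.1 i).2⟩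

theorem volumeReal_cubeHalfSpace_succ {k : ℕ} (w : Fin (k + 1) → ℝ) (t : ℝ) :
    volume.real (cubeHalfSpace w t) =
      ∫ s in (0 : ℝ)..1, volume.real (cubeHalfSpace (Fin.tail w) (t - w 0 * s)) := by
  have hmp := (volume_preserving_piFinSuccAbove (fun _ : Fin (k + 1) => ℝ) 0).symm
  have hmeas : MeasurableSet ((MeasurableEquiv.piFinSuccAbove (fun _ : Fin (k + 1) => ℝ) 0).symm ⁻¹'
      cubeHalfSpace w t) :=
    (MeasurableEquiv.measurable _) (isClosed_cubeHalfSpace w t).measurableSet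
  have hslice : ∀ s : ℝ, Prod.mk s ⁻¹'
      ((MeasurableEquiv.piFinSuccAbove (fun _ : Fin (k + 1) => ℝ) 0).symm ⁻¹' cubeHalfSpace w t) =
      {y | (0 ≤ s ∧ s ≤ 1) ∧ y ∈ cubeHalfSpace (Fin.tail w) (t - w 0 * s)} := by
    intro s
    ext y
    simp [cubeHalfSpace, MeasurableEquiv.piFinSuccAbove, Fin.forall_fin_succ, Fin.sum_univ_succ,
      Fin.tail, le_sub_iff_add_le', and_assoc]
  rw [Measure.real, ← hmp.measure_preimage_equiv, Measure.volume_eq_prod, Measure.prod_apply hmeas,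
    ← integral_toReal (measurable_measure_prodMk_left hmeas).aemeasurable
      (Filter.Eventually.of_forall fun s => ?_),
    ← setIntegral_eq_integral_of_forall_compl_eq_zero (s := Set.Icc 0 1),
    integral_Icc_eq_integral_Ioc, ← intervalIntegral.integral_of_le zero_le_one]
  · refine intervalIntegral.integral_congr fun s hs => ?_
    rw [Set.uIcc_of_le zero_le_one] at hs
    simp only [hslice]
    simp [hs.1, hs.2, Measure.real]
  · intro s hs
    rw [hslice]
    have : ¬ (0 ≤ s ∧ s ≤ 1) := hs
    simp [this]
  · rw [hslice]
    exact (measure_mono fun y hy => hy.2).trans_lt (volume_cubeHalfSpace_lt_top _ _)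

/-- The volume of the part of the cube in a half-space. The proof integrates over one coordinate
at a time; the signs of the entries of `w` play no role. -/
theorem volumeReal_cubeHalfSpace {k : ℕ} (w : Fin k → ℝ) (hw : ∀ i, w i ≠ 0) (t : ℝ) :
    volume.real (cubeHalfSpace w t) = alternatingSum k w t / (k.factorial * ∏ i, w i) := by
  induction k generalizing t with
  | zero =>
    by_cases ht : 0 ≤ t
    · have : cubeHalfSpace w t = Set.univ := by ext; simp [cubeHalfSpace, ht]
      simp [this, alternatingSum_zero, truncPow, ht, Measure.real, volume_pi]
    · have : cubeHalfSpace w t = ∅ := by ext; simp [cubeHalfSpace, not_le.1 ht]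
      simp [this, alternatingSum_zero, truncPow, ht]
  | succ k ih =>
    have ih' : ∀ s : ℝ, volume.real (cubeHalfSpace (Fin.tail w) (t - w 0 * s)) =
        alternatingSum k (Fin.tail w) (t - w 0 * s) / (k.factorial * ∏ i, Fin.tail w i) :=
      fun s => ih _ (fun i => hw _) _
    rw [volumeReal_cubeHalfSpace_succ]
    simp only [ih']
    rw [intervalIntegral.integral_div, integral_alternatingSum _ _ _ (hw 0), alternatingSum_succ,
      div_div]
    congr 1
    rw [Fin.prod_univ_succ, Nat.factorial_succ]
    push_cast
    simp only [Fin.tail]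
    ring

end CubeSections

/-! ### Volumes of simplices and of hyperplane sections of the cube -/

section ParametrizedVolumes

variable {n : ℕ}

/-- The `d`-volume of a set parametrized by an affine map with linear part given by `v`. If the
vectors `v k` are linearly dependent, both sides are `0`. -/
theorem euclideanHausdorffMeasure_image_add_sum {d : ℕ} (x : EuclideanSpace ℝ (Fin n))
    (v : Fin d → EuclideanSpace ℝ (Fin n)) (s : Set (Fin d → ℝ)) :
    μHE[d] ((fun y : Fin d → ℝ => x + ∑ k, y k • v k) '' s) =
      ENNReal.ofReal √(Matrix.gram ℝ v).det * volume s := by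
  let f : EuclideanSpace ℝ (Fin d) →ₗ[ℝ] EuclideanSpace ℝ (Fin n) :=
    Fintype.linearCombination ℝ v ∘ₗ (WithLp.linearEquiv 2 ℝ (Fin d → ℝ)).toLinearMap
  have hnorm : f.normDet = √(Matrix.gram ℝ v).det := by
    have hv : (fun k => f (EuclideanSpace.basisFun (Fin d) ℝ k)) = v := by
      ext k : 1
      simp [f]
    have h := f.normDet_sq_eq_det_gram (EuclideanSpace.basisFun (Fin d) ℝ)
    rw [hv] at h
    rw [← h]
    exact (Real.sqrt_sq f.normDet_nonneg).symm
  have himage : (fun y : Fin d → ℝ => x + ∑ k, y k • v k) '' s =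
      IsometryEquiv.addLeft x '' (f '' (WithLp.ofLp ⁻¹' s)) := by
    ext z
    constructor
    · rintro ⟨y, hy, rfl⟩
      exact ⟨_, ⟨WithLp.toLp 2 y, hy, rfl⟩, rfl⟩
    · rintro ⟨_, ⟨y, hy, rfl⟩, rfl⟩
      exact ⟨y.ofLp, hy, rfl⟩
  have hvol := f.euclideanHausdorffMeasure_image_eq_normDet_mul_volume (WithLp.ofLp ⁻¹' s)
  rw [finrank_euclideanSpace_fin] at hvol
  rw [himage, (IsometryEquiv.addLeft x).isometry.euclideanHausdorffMeasure_image, hvol, hnorm]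
  congr 1
  exact (EuclideanSpace.volume_preserving_symm_measurableEquiv_toLp
    (Fin d)).measure_preimage_equiv s

theorem alternatingSum_one_one (d : ℕ) : alternatingSum d (fun _ : Fin d => 1) 1 = 1 := by
  unfold alternatingSum
  rw [Finset.sum_eq_single ∅]
  · simp [truncPow]
  · intro K _ hK
    have hcard : 1 ≤ K.card := Finset.one_le_card.2 (Finset.nonempty_iff_ne_empty.2 hK)
    have hd : d ≠ 0 := by
      rintro rfl
      exact hK (Finset.eq_empty_of_isEmpty K)
    have : (1 : ℝ) ≤ K.card := by exact_mod_cast hcard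
    rw [truncPow_eq_max hd, max_eq_left (by simpa using this), zero_pow hd, mul_zero]
  · simp

theorem volume_cubeHalfSpace_one (d : ℕ) :
    volume (cubeHalfSpace (fun _ : Fin d => 1) 1) = ENNReal.ofReal (1 / d.factorial) := by
  rw [← ofReal_measureReal (volume_cubeHalfSpace_lt_top _ _).ne,
    volumeReal_cubeHalfSpace _ (by simp), alternatingSum_one_one]
  simp

/-- A simplex is the affine image of the corner `∑ y k ≤ 1` of the cube, with `p 0` the image of the
origin. -/
theorem convexHull_range_eq_image {d : ℕ} (p : Fin (d + 1) → EuclideanSpace ℝ (Fin n)) :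
    convexHull ℝ (Set.range p) = (fun y : Fin d → ℝ => p 0 + ∑ k, y k • (p k.succ - p 0)) ''
      cubeHalfSpace (fun _ => 1) 1 := by
  apply Set.Subset.antisymm
  · have hstd : convexHull ℝ (Set.range p) =
        Fintype.linearCombination ℝ p '' stdSimplex ℝ (Fin (d + 1)) := by
      rw [← convexHull_rangle_single_eq_stdSimplex, LinearMap.image_convexHull, ← Set.range_comp]
      congr 2
      ext i : 1
      simp
    rw [hstd]
    rintro _ ⟨y, ⟨hy, hsum⟩, rfl⟩
    rw [Fin.sum_univ_succ] at hsum
    have h0 := hy 0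
    refine ⟨fun k => y k.succ, ⟨fun i => ⟨hy _, ?_⟩, ?_⟩, ?_⟩
    · have := Finset.single_le_sum (f := fun k : Fin d => y k.succ) (fun k _ => hy _)
        (Finset.mem_univ i)
      dsimp only at this ⊢
      linarith
    · simp only [one_mul]
      linarith
    · simp only [Fintype.linearCombination_apply, Fin.sum_univ_succ, smul_sub,
        Finset.sum_sub_distrib, ← Finset.sum_smul]
      rw [show ∑ k : Fin d, y k.succ = 1 - y 0 by linarith]
      module
  · rintro _ ⟨y, ⟨hy, hsum⟩, rfl⟩
    simp only [one_mul] at hsum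
    have := (convex_convexHull ℝ (Set.range p)).sum_mem (t := Finset.univ)
      (w := (Fin.cons (1 - ∑ k, y k) y : Fin (d + 1) → ℝ)) (z := p)
      (fun i _ => by
        cases i using Fin.cases with
        | zero => simpa using hsum
        | succ i => simpa using (hy i).1)
      (by simp [Fin.sum_univ_succ]) (fun i _ => subset_convexHull ℝ _ ⟨i, rfl⟩)
    rw [Fin.sum_univ_succ] at this
    simp only [Fin.cons_zero, Fin.cons_succ] at this
    convert this using 1
    simp only [smul_sub, Finset.sum_sub_distrib, ← Finset.sum_smul]
    module

theorem euclideanHausdorffMeasure_convexHull_range {d : ℕ}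
    (p : Fin (d + 1) → EuclideanSpace ℝ (Fin n)) :
    μHE[d] (convexHull ℝ (Set.range p)) = ENNReal.ofReal (simplexVolume p) := by
  rw [convexHull_range_eq_image, euclideanHausdorffMeasure_image_add_sum, volume_cubeHalfSpace_one,
    ← ENNReal.ofReal_mul (Real.sqrt_nonneg _), simplexVolume, mul_one_div]

theorem volume_hyperplane_eq_zero {d : ℕ} {w : Fin d → ℝ} (hw : w ≠ 0) (c : ℝ) :
    volume {y : Fin d → ℝ | ∑ i, w i * y i = c} = 0 := by
  rcases Set.eq_empty_or_nonempty {y : Fin d → ℝ | ∑ i, w i * y i = c} with h | ⟨y₀, hy₀⟩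
  · rw [h, measure_empty]
  let f : (Fin d → ℝ) →ₗ[ℝ] ℝ := Fintype.linearCombination ℝ w
  have hf : ∀ y, f y = ∑ i, w i * y i := fun y => by
    simp [f, Fintype.linearCombination_apply, mul_comm]
  have hset : {y : Fin d → ℝ | ∑ i, w i * y i = c} = AffineSubspace.mk' y₀ f.ker := by
    ext y
    rw [SetLike.mem_coe, AffineSubspace.mem_mk', LinearMap.mem_ker, vsub_eq_sub, map_sub,
      sub_eq_zero, hf, hf, Set.mem_ofPred_eq, show ∑ i, w i * y₀ i = c from hy₀]
  rw [hset]
  refine Measure.addHaar_affineSubspace _ _ fun htop => hw ?_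
  have hker : f.ker = ⊤ := by
    rw [← AffineSubspace.direction_mk' y₀ f.ker, htop, AffineSubspace.direction_top]
  ext i
  have : f (Pi.single i 1) = 0 := LinearMap.mem_ker.1 (hker ▸ Submodule.mem_top)
  simpa [f] using this

theorem volumeReal_cube_slab {d : ℕ} {w : Fin d → ℝ} (hw : ∀ i, w i ≠ 0) (hd : d ≠ 0) {a b : ℝ}
    (hab : a ≤ b) :
    volume.real {y : Fin d → ℝ | (∀ i, 0 ≤ y i ∧ y i ≤ 1) ∧ a ≤ ∑ i, w i * y i ∧
      ∑ i, w i * y i ≤ b} =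
      (alternatingSum d w b - alternatingSum d w a) / (d.factorial * ∏ i, w i) := by
  have hw0 : w ≠ 0 := fun h => hw ⟨0, Nat.pos_of_ne_zero hd⟩ (congrFun h _)
  have hae : {y : Fin d → ℝ | (∀ i, 0 ≤ y i ∧ y i ≤ 1) ∧ a ≤ ∑ i, w i * y i ∧
      ∑ i, w i * y i ≤ b} =ᵐ[volume] (cubeHalfSpace w b \ cubeHalfSpace w a : Set _) := by
    have hnull : ∀ᵐ y : Fin d → ℝ, ∑ i, w i * y i ≠ a :=
      measure_eq_zero_iff_ae_notMem.1 (volume_hyperplane_eq_zero hw0 a)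
    filter_upwards [hnull] with y hy
    apply propext
    change ((∀ i, 0 ≤ y i ∧ y i ≤ 1) ∧ a ≤ ∑ i, w i * y i ∧ ∑ i, w i * y i ≤ b) ↔
      (((∀ i, 0 ≤ y i ∧ y i ≤ 1) ∧ ∑ i, w i * y i ≤ b) ∧
        ¬ ((∀ i, 0 ≤ y i ∧ y i ≤ 1) ∧ ∑ i, w i * y i ≤ a))
    constructor
    · rintro ⟨h1, h2, h3⟩
      exact ⟨⟨h1, h3⟩, fun h => hy (le_antisymm h.2 h2)⟩
    · rintro ⟨⟨h1, h3⟩, h2⟩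
      exact ⟨h1, le_of_not_ge fun h => h2 ⟨h1, h⟩, h3⟩
  rw [measureReal_congr hae, measureReal_sdiff
    (show cubeHalfSpace w a ⊆ cubeHalfSpace w b from fun y hy => ⟨hy.1, hy.2.trans hab⟩)
    (isClosed_cubeHalfSpace w a).measurableSet (volume_cubeHalfSpace_lt_top w b).ne,
    volumeReal_cubeHalfSpace w hw, volumeReal_cubeHalfSpace w hw, sub_div]

/-- The area of the section of the cube by the hyperplane `w ⬝ᵥ x = β`. The section is the graph
of an affine function over a slab of the cube of one dimension less. -/
theorem euclideanHausdorffMeasure_cube_hyperplane {d : ℕ} (hd : d ≠ 0) {w : Fin (d + 1) → ℝ}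
    (hw : ∀ i, w i ≠ 0) (β : ℝ) :
    μHE[d] {x : EuclideanSpace ℝ (Fin (d + 1)) | x ∈ unitCube (d + 1) ∧ ∑ i, w i * x i = β} =
      ENNReal.ofReal (‖(WithLp.toLp 2 w : EuclideanSpace ℝ (Fin (d + 1)))‖ /
        (d.factorial * ∏ i, w i) * alternatingSum d w β) := by
  have hw0 : w 0 ≠ 0 := hw 0
  let u : Fin d → ℝ := fun k => -(w k.succ) / w 0
  let v : Fin d → EuclideanSpace ℝ (Fin (d + 1)) :=
    fun k => WithLp.toLp 2 (Fin.cons (u k) (Pi.single k 1))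
  let x₀ : EuclideanSpace ℝ (Fin (d + 1)) := WithLp.toLp 2 (Fin.cons (β / w 0) 0)
  let s : Set (Fin d → ℝ) := {y | (∀ i, 0 ≤ y i ∧ y i ≤ 1) ∧
    0 ≤ (β - ∑ i, Fin.tail w i * y i) / w 0 ∧ (β - ∑ i, Fin.tail w i * y i) / w 0 ≤ 1}
  have hzero : ∀ y : Fin d → ℝ, (x₀ + ∑ k, y k • v k) 0 =
      (β - ∑ i, Fin.tail w i * y i) / w 0 := by
    intro y
    simp only [x₀, v, u, PiLp.add_apply, WithLp.ofLp_sum, Finset.sum_apply, PiLp.smul_apply,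
      Fin.cons_zero, smul_eq_mul, Fin.tail]
    rw [sub_div, sub_eq_add_neg, Finset.sum_div, ← Finset.sum_neg_distrib]
    congr 1
    exact Finset.sum_congr rfl fun i _ => by ring
  have hsucc : ∀ (y : Fin d → ℝ) (i : Fin d), (x₀ + ∑ k, y k • v k) i.succ = y i := by
    intro y i
    simp [x₀, v, WithLp.ofLp_sum, Finset.sum_apply, Pi.single_apply]
  have himage : {x : EuclideanSpace ℝ (Fin (d + 1)) | x ∈ unitCube (d + 1) ∧
      ∑ i, w i * x i = β} = (fun y : Fin d → ℝ => x₀ + ∑ k, y k • v k) '' s := by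
    ext x
    constructor
    · rintro ⟨hx, hsum⟩
      rw [Fin.sum_univ_succ] at hsum
      have hx0 : (β - ∑ i, Fin.tail w i * x i.succ) / w 0 = x 0 := by
        rw [div_eq_iff hw0]
        simp only [Fin.tail]
        linarith
      refine ⟨fun i => x i.succ, ⟨fun i => hx _, ?_⟩, ?_⟩
      · rw [hx0]
        exact hx 0
      · ext i
        cases i using Fin.cases with
        | zero => exact (hzero _).trans hx0
        | succ i => exact hsucc _ i
    · rintro ⟨y, ⟨hy, hy0⟩, rfl⟩
      refine ⟨fun i => ?_, ?_⟩
      · cases i using Fin.cases with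
        | zero => simpa only [hzero] using hy0
        | succ i => simpa only [hsucc] using hy i
      · rw [Fin.sum_univ_succ]
        simp only [hzero, hsucc, Fin.tail]
        rw [mul_div_cancel₀ _ hw0]
        ring
  have hgram : (Matrix.gram ℝ v).det = (‖(WithLp.toLp 2 w : EuclideanSpace ℝ (Fin (d + 1)))‖ /
      |w 0|) ^ 2 := by
    have h1 : Matrix.gram ℝ v = 1 + Matrix.replicateCol Unit u * Matrix.replicateRow Unit u := by
      ext k l
      simp [Matrix.gram_apply, v, EuclideanSpace.inner_eq_star_dotProduct, dotProduct,
        Fin.sum_univ_succ, Pi.single_apply, Matrix.mul_apply, Matrix.one_apply, add_comm, eq_comm,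
        mul_comm]
    rw [h1, Matrix.det_one_add_replicateCol_mul_replicateRow, div_pow, sq_abs,
      EuclideanSpace.real_norm_sq_eq, Fin.sum_univ_succ, add_div, div_self (pow_ne_zero 2 hw0),
      Finset.sum_div]
    congr 1
    exact Finset.sum_congr rfl fun i _ => by simp only [u]; ring
  have hs : volume.real s = |w 0| * (alternatingSum d w β / (d.factorial * ∏ i, w i)) := by
    have htail : ∀ i, Fin.tail w i ≠ 0 := fun i => hw _
    have hP : ∏ i, Fin.tail w i ≠ 0 := Finset.prod_ne_zero_iff.2 fun i _ => htail i
    have hfac : (d.factorial : ℝ) ≠ 0 := by positivity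
    rw [alternatingSum_succ, Fin.prod_univ_succ]
    change _ = |w 0| * (_ / (d.factorial * (w 0 * ∏ i, Fin.tail w i)))
    rcases lt_or_gt_of_ne hw0 with hneg | hpos
    · have hset : s = {y | (∀ i, 0 ≤ y i ∧ y i ≤ 1) ∧ β ≤ ∑ i, Fin.tail w i * y i ∧
          ∑ i, Fin.tail w i * y i ≤ β - w 0} := by
        ext y
        simp only [s, Set.mem_ofPred_eq, le_div_iff_of_neg hneg, div_le_iff_of_neg hneg]
        constructor <;> rintro ⟨h1, h2, h3⟩ <;> exact ⟨h1, by linarith, by linarith⟩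
      rw [hset, volumeReal_cube_slab htail hd (by linarith), abs_of_neg hneg]
      field_simp
      ring
    · have hset : s = {y | (∀ i, 0 ≤ y i ∧ y i ≤ 1) ∧ β - w 0 ≤ ∑ i, Fin.tail w i * y i ∧
          ∑ i, Fin.tail w i * y i ≤ β} := by
        ext y
        simp only [s, Set.mem_ofPred_eq, le_div_iff₀ hpos, div_le_iff₀ hpos]
        constructor <;> rintro ⟨h1, h2, h3⟩ <;> exact ⟨h1, by linarith, by linarith⟩
      rw [hset, volumeReal_cube_slab htail hd (by linarith), abs_of_pos hpos]
      field_simp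
  have hfin : volume s ≠ ⊤ := by
    refine ((measure_mono fun y hy => ?_).trans_lt
      (isCompact_Icc (a := (0 : Fin d → ℝ)) (b := 1)).measure_lt_top).ne
    exact ⟨fun i => (hy.1 i).1, fun i => (hy.1 i).2⟩
  rw [himage, euclideanHausdorffMeasure_image_add_sum, hgram, Real.sqrt_sq (by positivity),
    ← ofReal_measureReal hfin, hs, ← ENNReal.ofReal_mul (by positivity)]
  congr 1
  have : |w 0| ≠ 0 := abs_ne_zero.2 hw0
  field_simp

end ParametrizedVolumes

/-! ### Sets of small affine dimension -/

section Thin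

variable {n : ℕ}

/-- A set is thin in dimension `d` if finitely many affine subspaces of dimension less than `d`
cover it. -/
def IsThin (d : ℕ) (A : Set (EuclideanSpace ℝ (Fin n))) : Prop :=
  ∃ N : Finset (AffineSubspace ℝ (EuclideanSpace ℝ (Fin n))),
    (∀ B ∈ N, Module.finrank ℝ B.direction < d) ∧ A ⊆ ⋃ B ∈ N, (B : Set _)

variable {d : ℕ} {A B : Set (EuclideanSpace ℝ (Fin n))}

theorem IsThin.mono (hB : IsThin d B) (h : A ⊆ B) : IsThin d A :=
  hB.imp fun _ hN => ⟨hN.1, h.trans hN.2⟩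

theorem isThin_empty : IsThin d (∅ : Set (EuclideanSpace ℝ (Fin n))) :=
  ⟨∅, by simp, by simp⟩

theorem isThin_of_finrank_lt (h : Module.finrank ℝ (vectorSpan ℝ A) < d) : IsThin d A :=
  ⟨{affineSpan ℝ A}, fun B hB => by
    rwa [Finset.mem_singleton.1 hB, direction_affineSpan],
    by simpa using subset_affineSpan ℝ A⟩

theorem isThin_singleton (x : EuclideanSpace ℝ (Fin n)) : IsThin (d + 1) {x} :=
  isThin_of_finrank_lt (by rw [vectorSpan_singleton, finrank_bot]; exact Nat.succ_pos d)

theorem IsThin.union (hA : IsThin d A) (hB : IsThin d B) : IsThin d (A ∪ B) := by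
  obtain ⟨M, hM, hAM⟩ := hA
  obtain ⟨N, hN, hBN⟩ := hB
  refine ⟨M ∪ N, fun C hC => (Finset.mem_union.1 hC).elim (hM C) (hN C), ?_⟩
  rw [Finset.set_biUnion_union]
  exact Set.union_subset_union hAM hBN

theorem isThin_iUnion {κ : Type*} [Finite κ] {A : κ → Set (EuclideanSpace ℝ (Fin n))}
    (h : ∀ c, IsThin d (A c)) : IsThin d (⋃ c, A c) := by
  have := Fintype.ofFinite κ
  choose N hN hA using h
  refine ⟨Finset.univ.biUnion N, fun B hB => ?_, ?_⟩
  · obtain ⟨c, -, hc⟩ := Finset.mem_biUnion.1 hB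
    exact hN c B hc
  · refine Set.iUnion_subset fun c => (hA c).trans (Set.iUnion₂_subset fun B hB => ?_)
    exact Set.subset_iUnion₂_of_subset B (Finset.mem_biUnion.2 ⟨c, Finset.mem_univ _, hB⟩)
      subset_rfl

/-- The cone with apex `v` over a set that is thin in dimension `d` is thin in dimension `d + 1`. -/
theorem IsThin.convexJoin (hA : IsThin d A) (v : EuclideanSpace ℝ (Fin n)) :
    IsThin (d + 1) (convexJoin ℝ {v} A) := by
  obtain ⟨N, hN, hAN⟩ := hA
  refine ⟨N.image fun B : AffineSubspace ℝ (EuclideanSpace ℝ (Fin n)) =>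
    affineSpan ℝ (insert v (B : Set (EuclideanSpace ℝ (Fin n)))), ?_, ?_⟩
  · intro C hC
    obtain ⟨B, hB, rfl⟩ := Finset.mem_image.1 hC
    rw [direction_affineSpan]
    have h1 := finrank_vectorSpan_insert_le B v
    have h2 := hN B hB
    omega
  · intro x hx
    obtain ⟨_, rfl, a, ha, hxa⟩ := mem_convexJoin.1 hx
    obtain ⟨B, hB, haB⟩ := Set.mem_iUnion₂.1 (hAN ha)
    refine Set.mem_iUnion₂.2 ⟨_, Finset.mem_image_of_mem _ hB, ?_⟩
    refine (affineSpan ℝ (insert _ (B : Set _))).convex.segment_subset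
      (subset_affineSpan ℝ _ (Set.mem_insert _ _))
      (subset_affineSpan ℝ _ (Set.mem_insert_of_mem _ haB)) hxa

theorem IsThin.euclideanHausdorffMeasure_eq_zero (hA : IsThin d A) : μHE[d] A = 0 := by
  obtain ⟨N, hN, hAN⟩ := hA
  refine measure_mono_null hAN ((measure_biUnion_null_iff N.countable_toSet).2 fun B hB => ?_)
  rcases (B : Set (EuclideanSpace ℝ (Fin n))).eq_empty_or_nonempty with h | h
  · rw [h, measure_empty]
  · have hdim := Real.Convex.dimH_eq_finrank_vectorSpan B.convex h
    have hlt : dimH (B : Set (EuclideanSpace ℝ (Fin n))) < (d : NNReal) := by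
      rw [hdim, ← AffineSubspace.direction_eq_vectorSpan]
      exact_mod_cast hN B hB
    rw [Measure.euclideanHausdorffMeasure_def, Measure.smul_apply]
    have := hausdorffMeasure_of_dimH_lt hlt
    rw [NNReal.coe_natCast] at this
    rw [this, smul_zero]

/-- A set on which a linear functional is constant has smaller dimension than any set that contains
it and a further point with another value of the functional. -/
theorem finrank_vectorSpan_lt {a y : EuclideanSpace ℝ (Fin n)} {r : ℝ} (hBA : B ⊆ A)
    (hB : ∀ x ∈ B, ⟪a, x⟫ = r) (hne : B.Nonempty) (hy : y ∈ A) (hyr : ⟪a, y⟫ ≠ r) :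
    Module.finrank ℝ (vectorSpan ℝ B) < Module.finrank ℝ (vectorSpan ℝ A) := by
  obtain ⟨x, hx⟩ := hne
  refine Submodule.finrank_lt_finrank_of_lt (lt_of_le_of_ne (vectorSpan_mono ℝ hBA) fun h => hyr ?_)
  have hperp : vectorSpan ℝ B ≤ (Submodule.span ℝ {a})ᗮ := by
    rw [vectorSpan, Submodule.span_le]
    rintro _ ⟨p, hp, q, hq, rfl⟩
    refine Submodule.mem_orthogonal_singleton_iff_inner_right.2 ?_
    change ⟪a, p - q⟫ = 0
    rw [inner_sub_right, hB p hp, hB q hq, sub_self]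
  have hmem : y - x ∈ vectorSpan ℝ B := h ▸ vsub_mem_vectorSpan ℝ hy (hBA hx)
  have := Submodule.mem_orthogonal_singleton_iff_inner_right.1 (hperp hmem)
  rw [inner_sub_right, hB x hx, sub_eq_zero] at this
  exact this

end Thin

/-! ### Triangulation of a polytope by pulling vertices -/

theorem convexHull_range_cons {n d : ℕ} (v : EuclideanSpace ℝ (Fin n))
    (p : Fin (d + 1) → EuclideanSpace ℝ (Fin n)) :
    convexHull ℝ (Set.range (Fin.cons v p : Fin (d + 2) → EuclideanSpace ℝ (Fin n))) =
      convexJoin ℝ {v} (convexHull ℝ (Set.range p)) := by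
  rw [Fin.range_cons, convexHull_insert (Set.range_nonempty p)]

namespace LinearSystem

variable {n : ℕ} {ι : Type} {L : LinearSystem n ι}

theorem finrank_vectorSpan_face_insert_le {d : ℕ} {C : Set ι} {c : ι}
    {v : EuclideanSpace ℝ (Fin n)} (hv : v ∈ L.face C) (hc : ¬ L.Binding c v)
    (hdim : Module.finrank ℝ (vectorSpan ℝ (L.face C)) ≤ d + 1) :
    Module.finrank ℝ (vectorSpan ℝ (L.face (insert c C))) ≤ d := by
  rcases (L.face (insert c C)).eq_empty_or_nonempty with h | h
  · rw [h, vectorSpan_empty, finrank_bot]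
    exact Nat.zero_le _
  · have := finrank_vectorSpan_lt (face_mono (Set.subset_insert c C))
      (fun x hx => hx.2 c (Set.mem_insert _ _)) h hv hc
    omega

/-- A ray from a point `v` of a face through another point `x` leaves the face at a point `y` of a
smaller face that does not contain `v`. -/
theorem exists_mem_segment_face_insert [Finite ι] (hL : IsCompact {x | L.Feasible x}) {C : Set ι}
    {v x : EuclideanSpace ℝ (Fin n)} (hv : v ∈ L.face C) (hx : x ∈ L.face C) (hxv : x ≠ v) :
    ∃ c, ¬ L.Binding c v ∧ ∃ y ∈ L.face (insert c C), x ∈ segment ℝ v y := by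
  have he : ⟪L.eqNormal, x - v⟫ = 0 := inner_eqNormal_sub hv.1 hx.1
  obtain ⟨t, ht⟩ := exists_isGreatest_feasible hL hv.1 (sub_ne_zero.2 hxv)
  have ht1 : 1 ≤ t := ht.2 (by simpa using hx.1)
  obtain ⟨c, hc, hneg⟩ := exists_binding_of_isGreatest he ht
  refine ⟨c, fun hcv => ?_, v + t • (x - v), ⟨ht.1, ?_⟩, ?_⟩
  · exact hneg.not_ge (inner_normal_sub_nonneg hx.1 hcv)
  · rintro c' (rfl | hc')
    · exact hc
    · change ⟪L.normal c', v + t • (x - v)⟫ = _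
      rw [inner_add_right, real_inner_smul_right, inner_sub_right,
        show ⟪L.normal c', x⟫ = _ from hx.2 c' hc', show ⟪L.normal c', v⟫ = _ from hv.2 c' hc',
        sub_self, mul_zero, add_zero]
  · have ht0 : t ≠ 0 := by linarith
    refine ⟨1 - t⁻¹, t⁻¹, sub_nonneg.2 (inv_le_one_of_one_le₀ ht1), by positivity, by ring, ?_⟩
    rw [smul_add, smul_smul, inv_mul_cancel₀ ht0]
    module

/-- Cones from a common apex `v` over parts of two faces that do not contain `v` meet only in `v`
and in the cone over the common part, since a ray from `v` leaves the solution set only once. -/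
theorem convexJoin_inter_subset {c c' : ι} {v : EuclideanSpace ℝ (Fin n)} (hv : L.Feasible v)
    (hc : ¬ L.Binding c v) (hc' : ¬ L.Binding c' v) {A B : Set (EuclideanSpace ℝ (Fin n))}
    (hA : ∀ x ∈ A, L.Feasible x ∧ L.Binding c x) (hB : ∀ x ∈ B, L.Feasible x ∧ L.Binding c' x) :
    convexJoin ℝ {v} A ∩ convexJoin ℝ {v} B ⊆ {v} ∪ convexJoin ℝ {v} (A ∩ B) := by
  -- along a ray from `v`, no feasible point `z` lies beyond a point `y` at which `c` is binding
  have key : ∀ {c : ι} {y z : EuclideanSpace ℝ (Fin n)} {s t : ℝ}, ¬ L.Binding c v →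
      L.Binding c y → L.Feasible z → 0 < t → s • (y - v) = t • (z - v) → s ≤ t := by
    intro c y z s t hcv hcy hz ht h
    have hlt : L.rhs c < ⟪L.normal c, v⟫ := lt_of_le_of_ne (hv.2 c) (Ne.symm hcv)
    have h1 := congrArg (fun u => ⟪L.normal c, u⟫) h
    simp only [real_inner_smul_right, inner_sub_right] at h1
    rw [show ⟪L.normal c, y⟫ = L.rhs c from hcy] at h1
    by_contra! hst
    have h2 := hz.2 c
    nlinarith
  rintro x ⟨hxA, hxB⟩
  obtain ⟨_, hv', y, hy, hxy⟩ := mem_convexJoin.1 hxA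
  rw [Set.mem_singleton_iff.1 hv'] at hxy
  obtain ⟨_, hv'', z, hz, hxz⟩ := mem_convexJoin.1 hxB
  rw [Set.mem_singleton_iff.1 hv''] at hxz
  have hxy' := hxy
  rw [segment_eq_image'] at hxy hxz
  obtain ⟨s, ⟨hs0, -⟩, hs⟩ := hxy
  obtain ⟨t, ⟨ht0, -⟩, ht⟩ := hxz
  dsimp only at hs ht
  have heq : s • (y - v) = t • (z - v) := by
    rw [← ht] at hs
    exact add_left_cancel hs
  rcases hs0.eq_or_lt with rfl | hs0
  · left
    simpa using hs.symm
  rcases ht0.eq_or_lt with rfl | ht0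
  · left
    simpa using ht.symm
  right
  have hst : s = t := le_antisymm (key hc (hA y hy).2 (hB z hz).1 ht0 heq)
    (key hc' (hB z hz).2 (hA y hy).1 hs0 heq.symm)
  have hyz : y = z := by
    rw [hst] at heq
    exact sub_left_injective (smul_right_injective _ ht0.ne' heq)
  exact mem_convexJoin.2 ⟨v, rfl, y, ⟨hy, hyz ▸ hz⟩, hxy'⟩

/-- Two different faces of a polytope of dimension at most `d` meet in a set of dimension less
than `d`. -/
theorem isThin_face_inter_face {d : ℕ} {C D : Set ι} (hCD : L.face C ≠ L.face D)
    (hC : Module.finrank ℝ (vectorSpan ℝ (L.face C)) ≤ d)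
    (hD : Module.finrank ℝ (vectorSpan ℝ (L.face D)) ≤ d) : IsThin d (L.face C ∩ L.face D) := by
  have key : ∀ {C D : Set ι}, ¬ L.face C ⊆ L.face D →
      Module.finrank ℝ (vectorSpan ℝ (L.face C)) ≤ d → IsThin d (L.face C ∩ L.face D) := by
    intro C D hsub hC
    rcases (L.face C ∩ L.face D).eq_empty_or_nonempty with h | h
    · exact h ▸ isThin_empty
    obtain ⟨y, hy, hyD⟩ := Set.not_subset.1 hsub
    obtain ⟨c, hc, hcy⟩ : ∃ c ∈ D, ¬ L.Binding c y := by
      by_contra! hcon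
      exact hyD ⟨hy.1, hcon⟩
    exact isThin_of_finrank_lt ((finrank_vectorSpan_lt Set.inter_subset_left
      (fun x hx => hx.2.2 c hc) h hy hcy).trans_le hC)
  by_cases hsub : L.face C ⊆ L.face D
  · rw [Set.inter_comm]
    exact key (fun h => hCD (hsub.antisymm h)) hD
  · exact key hsub hC

theorem faceVertices_filter [Finite ι] (C : Set ι) (c : ι) :
    (L.faceVertices C).filter (fun x => L.Binding c x) = L.faceVertices (insert c C) := by
  ext x
  simp only [Finset.mem_filter, mem_faceVertices, Set.forall_mem_insert]
  tauto

variable [Fintype ι] {pick : Finset (EuclideanSpace ℝ (Fin n)) → EuclideanSpace ℝ (Fin n)}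

/-- The recursion of `simplices` on a face: the sets of vertices it passes to are again the vertex
sets of faces. -/
theorem mem_simplices_succ {d : ℕ} {C : Set ι} {p : Fin (d + 2) → EuclideanSpace ℝ (Fin n)} :
    p ∈ L.simplices pick (d + 1) (L.faceVertices C) ↔
      ∃ c, pick (L.faceVertices C) ∉ L.faceVertices (insert c C) ∧
        ∃ q ∈ L.simplices pick d (L.faceVertices (insert c C)),
          p = Fin.cons (pick (L.faceVertices C)) q := by
  simp only [simplices, Finset.mem_biUnion, Finset.mem_filter, Finset.mem_image, Finset.mem_univ,
    true_and, faceVertices_filter]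
  constructor
  · rintro ⟨_, ⟨⟨c, rfl⟩, hc⟩, q, hq, rfl⟩
    exact ⟨c, hc, q, hq, rfl⟩
  · rintro ⟨c, hc, q, hq, rfl⟩
    exact ⟨_, ⟨⟨c, rfl⟩, hc⟩, q, hq, rfl⟩

theorem range_subset_of_mem_simplices
    (hpick : ∀ T : Finset (EuclideanSpace ℝ (Fin n)), T.Nonempty → pick T ∈ T)
    {d : ℕ} {C : Set ι}
    {p : Fin (d + 1) → EuclideanSpace ℝ (Fin n)}
    (hp : p ∈ L.simplices pick d (L.faceVertices C)) :
    Set.range p ⊆ (L.faceVertices C : Set _) := by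
  induction d generalizing C with
  | zero =>
    obtain ⟨x, hx, rfl⟩ := Finset.mem_image.1 hp
    rintro _ ⟨_, rfl⟩
    exact hx
  | succ d ih =>
    obtain ⟨c, hc, q, hq, rfl⟩ := mem_simplices_succ.1 hp
    have hq' : Set.range q ⊆ (L.faceVertices C : Set _) := (ih hq).trans
      (by rw [← faceVertices_filter]; exact Finset.coe_subset.2 (Finset.filter_subset _ _))
    rw [Fin.range_cons]
    exact Set.insert_subset (hpick _ ⟨q 0, hq' ⟨0, rfl⟩⟩) hq'

theorem convexHull_range_subset_face
    (hpick : ∀ T : Finset (EuclideanSpace ℝ (Fin n)), T.Nonempty → pick T ∈ T)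
    {d : ℕ} {C : Set ι}
    {p : Fin (d + 1) → EuclideanSpace ℝ (Fin n)}
    (hp : p ∈ L.simplices pick d (L.faceVertices C)) :
    convexHull ℝ (Set.range p) ⊆ L.face C :=
  convexHull_min ((range_subset_of_mem_simplices hpick hp).trans (faceVertices_subset_face C))
    (convex_face C)

theorem pick_mem_of_mem_simplices
    (hpick : ∀ T : Finset (EuclideanSpace ℝ (Fin n)), T.Nonempty → pick T ∈ T)
    {d : ℕ} {C : Set ι}
    {p : Fin (d + 1) → EuclideanSpace ℝ (Fin n)}
    (hp : p ∈ L.simplices pick d (L.faceVertices C)) :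
    pick (L.faceVertices C) ∈ L.faceVertices C :=
  hpick _ ⟨p 0, range_subset_of_mem_simplices hpick hp ⟨0, rfl⟩⟩

/-- The simplices cover the face, up to a set of smaller dimension. -/
theorem isThin_face_sdiff_simplices
    (hpick : ∀ T : Finset (EuclideanSpace ℝ (Fin n)), T.Nonempty → pick T ∈ T)
    (hL : IsCompact {x | L.Feasible x}) {d : ℕ} {C : Set ι}
    (hdim : Module.finrank ℝ (vectorSpan ℝ (L.face C)) ≤ d) :
    IsThin d (L.face C \ ⋃ p ∈ L.simplices pick d (L.faceVertices C),
      convexHull ℝ (Set.range p)) := by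
  have hvert : (L.face C).Nonempty → (L.faceVertices C).Nonempty := fun h => by
    rw [← convexHull_faceVertices hL C, convexHull_nonempty_iff] at h
    exact h
  induction d generalizing C with
  | zero =>
    refine isThin_empty.mono fun x hx => ?_
    obtain ⟨v, hv⟩ := hvert ⟨x, hx.1⟩
    have hbot : vectorSpan ℝ (L.face C) = ⊥ :=
      Submodule.finrank_eq_zero.1 (Nat.le_zero.1 hdim)
    have hxv : x = v := by
      have := vsub_mem_vectorSpan ℝ hx.1 (faceVertices_subset_face C hv)
      rw [hbot, Submodule.mem_bot] at this
      exact sub_eq_zero.1 this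
    refine hx.2 (Set.mem_iUnion₂.2 ⟨fun _ => v, Finset.mem_image.2 ⟨v, hv, rfl⟩, ?_⟩)
    exact subset_convexHull ℝ _ ⟨0, hxv.symm⟩
  | succ d ih =>
    set v := pick (L.faceVertices C) with hvdef
    have hthin : ∀ c : {c // ¬ L.Binding c v}, v ∈ L.face C → IsThin (d + 1)
        (convexJoin ℝ {v} (L.face (insert c.1 C) \
          ⋃ p ∈ L.simplices pick d (L.faceVertices (insert c.1 C)),
            convexHull ℝ (Set.range p))) := fun c hv =>
      (ih (finrank_vectorSpan_face_insert_le hv c.2 hdim) fun h => by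
        rw [← convexHull_faceVertices hL, convexHull_nonempty_iff] at h
        exact h).convexJoin v
    by_cases hne : (L.face C).Nonempty
    swap
    · exact isThin_empty.mono fun x hx => hne ⟨x, hx.1⟩
    have hv : v ∈ L.face C := faceVertices_subset_face C (hpick _ (hvert hne))
    refine ((isThin_singleton v).union (isThin_iUnion fun c => hthin c hv)).mono ?_
    rintro x ⟨hx, hxn⟩
    by_cases hxv : x = v
    · exact Or.inl hxv
    obtain ⟨c, hc, y, hy, hxy⟩ := exists_mem_segment_face_insert hL hv hx hxv
    refine Or.inr (Set.mem_iUnion.2 ⟨⟨c, hc⟩, mem_convexJoin.2 ⟨v, rfl, y, ⟨hy, fun hyp => hxn ?_⟩,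
      hxy⟩⟩)
    obtain ⟨q, hq, hyq⟩ := Set.mem_iUnion₂.1 hyp
    refine Set.mem_iUnion₂.2
      ⟨Fin.cons v q, mem_simplices_succ.2 ⟨c, fun h => hc ?_, q, hq, rfl⟩, ?_⟩
    · exact (mem_faceVertices.1 h).2 c (Set.mem_insert _ _)
    · rw [convexHull_range_cons]
      exact mem_convexJoin.2 ⟨v, rfl, y, hyq, hxy⟩

/-- Different simplices of the triangulation overlap in a set of smaller dimension. -/
theorem isThin_inter_of_mem_simplices
    (hpick : ∀ T : Finset (EuclideanSpace ℝ (Fin n)), T.Nonempty → pick T ∈ T)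
    {d : ℕ} {C : Set ι}
    (hdim : Module.finrank ℝ (vectorSpan ℝ (L.face C)) ≤ d)
    {p q : Fin (d + 1) → EuclideanSpace ℝ (Fin n)}
    (hp : p ∈ L.simplices pick d (L.faceVertices C))
    (hq : q ∈ L.simplices pick d (L.faceVertices C)) (hpq : p ≠ q) :
    IsThin d (convexHull ℝ (Set.range p) ∩ convexHull ℝ (Set.range q)) := by
  induction d generalizing C with
  | zero =>
    obtain ⟨x, hx, rfl⟩ := Finset.mem_image.1 hp
    obtain ⟨y, hy, rfl⟩ := Finset.mem_image.1 hq
    have hbot : vectorSpan ℝ (L.face C) = ⊥ :=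
      Submodule.finrank_eq_zero.1 (Nat.le_zero.1 hdim)
    have := vsub_mem_vectorSpan ℝ (faceVertices_subset_face C hx) (faceVertices_subset_face C hy)
    rw [hbot, Submodule.mem_bot] at this
    exact absurd (funext fun _ => sub_eq_zero.1 this) hpq
  | succ d ih =>
    have hvF := pick_mem_of_mem_simplices hpick hp
    obtain ⟨c, hc, p', hp', rfl⟩ := mem_simplices_succ.1 hp
    obtain ⟨c', hc', q', hq', rfl⟩ := mem_simplices_succ.1 hq
    set v := pick (L.faceVertices C) with hvdef
    have hv : v ∈ L.face C := faceVertices_subset_face C hvF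
    have hbind : ∀ {c : ι}, v ∉ L.faceVertices (insert c C) → ¬ L.Binding c v := fun h hb =>
      h (faceVertices_filter (L := L) C _ ▸ Finset.mem_filter.2 ⟨hvF, hb⟩)
    have hsubp := convexHull_range_subset_face hpick hp'
    have hsubq := convexHull_range_subset_face hpick hq'
    have hdimp := finrank_vectorSpan_face_insert_le hv (hbind hc) hdim
    have hdimq := finrank_vectorSpan_face_insert_le hv (hbind hc') hdim
    rw [convexHull_range_cons, convexHull_range_cons]
    refine ((isThin_singleton v).union (IsThin.convexJoin ?_ v)).mono
      (convexJoin_inter_subset hv.1 (hbind hc) (hbind hc')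
        (fun x hx => ⟨(hsubp hx).1, (hsubp hx).2 c (Set.mem_insert _ _)⟩)
        (fun x hx => ⟨(hsubq hx).1, (hsubq hx).2 c' (Set.mem_insert _ _)⟩))
    by_cases hF : L.faceVertices (insert c C) = L.faceVertices (insert c' C)
    · exact ih hdimp hp' (hF ▸ hq') fun h => hpq (h ▸ rfl)
    · refine (isThin_face_inter_face (fun h => hF ?_) hdimp hdimq).mono
        (Set.inter_subset_inter hsubp hsubq)
      rw [← Finset.coe_inj, ← extremePoints_face, ← extremePoints_face, h]

theorem euclideanHausdorffMeasure_face
    (hpick : ∀ T : Finset (EuclideanSpace ℝ (Fin n)), T.Nonempty → pick T ∈ T)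
    (hL : IsCompact {x | L.Feasible x}) {d : ℕ} {C : Set ι}
    (hdim : Module.finrank ℝ (vectorSpan ℝ (L.face C)) ≤ d) :
    μHE[d] (L.face C) =
      ENNReal.ofReal (volumeFromVertices L pick d (L.faceVertices C)) := by
  have hsub : (⋃ p ∈ L.simplices pick d (L.faceVertices C), convexHull ℝ (Set.range p)) ⊆
      L.face C := Set.iUnion₂_subset fun p hp => convexHull_range_subset_face hpick hp
  have hae : μHE[d] (L.face C) =
      μHE[d] (⋃ p ∈ L.simplices pick d (L.faceVertices C), convexHull ℝ (Set.range p)) := by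
    refine le_antisymm ?_ (measure_mono hsub)
    refine (measure_le_inter_add_sdiff _ _ (⋃ p ∈ L.simplices pick d (L.faceVertices C),
      convexHull ℝ (Set.range p))).trans ?_
    rw [(isThin_face_sdiff_simplices hpick hL hdim).euclideanHausdorffMeasure_eq_zero, add_zero]
    exact measure_mono Set.inter_subset_right
  rw [hae, measure_biUnion_finset₀, volumeFromVertices, ENNReal.ofReal_sum_of_nonneg]
  · exact Finset.sum_congr rfl fun p _ => euclideanHausdorffMeasure_convexHull_range p
  · exact fun p _ => div_nonneg (Real.sqrt_nonneg _) (Nat.cast_nonneg _)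
  · exact fun p hp q hq hpq =>
      (isThin_inter_of_mem_simplices hpick hdim hp hq hpq).euclideanHausdorffMeasure_eq_zero
  · exact fun p _ => ((Set.finite_range p).isClosed_convexHull ℝ).measurableSet.nullMeasurableSet

end LinearSystem

/-! ### The decision boundary -/

section DecisionBoundary

variable {n m : ℕ}

theorem isBounded_unitCube (n : ℕ) : Bornology.IsBounded (unitCube n) := by
  refine ((isCompact_Icc (a := (0 : Fin n → ℝ)) (b := 1)).image
    (PiLp.continuous_toLp 2 _)).isBounded.subset fun x hx => ?_
  exact ⟨x.ofLp, ⟨fun i => (hx i).1, fun i => (hx i).2⟩, rfl⟩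

theorem setOf_feasible_boundarySystem (W : Matrix (Fin m) (Fin n) ℝ) (b : Fin m → ℝ)
    (i j : Fin m) : {x | (boundarySystem W b i j).Feasible x} = decisionBoundary W b i j :=
  Set.ext fun x => feasible_boundarySystem_iff W b i j x

theorem isCompact_feasible_boundarySystem (W : Matrix (Fin m) (Fin n) ℝ) (b : Fin m → ℝ)
    (i j : Fin m) : IsCompact {x | (boundarySystem W b i j).Feasible x} := by
  refine Metric.isCompact_of_isClosed_isBounded
    (LinearSystem.face_empty (L := boundarySystem W b i j) ▸ LinearSystem.isClosed_face ∅) ?_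
  rw [setOf_feasible_boundarySystem]
  exact (isBounded_unitCube n).subset fun x hx => hx.1

theorem affineDim_decisionBoundary_le (W : Matrix (Fin m) (Fin n) ℝ) (b : Fin m → ℝ)
    {i j : Fin m} (hij : W i ≠ W j) : affineDim (decisionBoundary W b i j) ≤ n - 1 := by
  let w : EuclideanSpace ℝ (Fin n) := WithLp.toLp 2 (W i - W j)
  have hw : w ≠ 0 := fun h => hij (sub_eq_zero.1 (congrArg WithLp.ofLp h))
  have hle : vectorSpan ℝ (decisionBoundary W b i j) ≤ (Submodule.span ℝ {w})ᗮ := by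
    rw [← setOf_feasible_boundarySystem, vectorSpan, Submodule.span_le]
    rintro _ ⟨x, hx, y, hy, rfl⟩
    exact Submodule.mem_orthogonal_singleton_iff_inner_right.2
      (LinearSystem.inner_eqNormal_sub (L := boundarySystem W b i j) hy hx)
  have h1 := Submodule.finrank_mono hle
  have h2 := (Submodule.span ℝ {w}).finrank_add_finrank_orthogonal
  rw [finrank_span_singleton hw, finrank_euclideanSpace_fin] at h2
  unfold affineDim
  omega

/-- The boundary lies in the section of the cube by the hyperplane on which the outputs of `i` and
`j` agree. -/
theorem decisionBoundary_subset_hyperplane (W : Matrix (Fin m) (Fin n) ℝ) (b : Fin m → ℝ)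
    (i j : Fin m) : decisionBoundary W b i j ⊆
      {x | x ∈ unitCube n ∧ ∑ k, (W i k - W j k) * x k = -b i + b j} := by
  rintro x ⟨hx, heq, -⟩
  refine ⟨hx, ?_⟩
  simp only [modelOutput, Pi.add_apply, Matrix.mulVec, dotProduct] at heq
  simp only [sub_mul, Finset.sum_sub_distrib]
  linarith

end DecisionBoundary

theorem mainTheorem7 {n m : ℕ} (hn : 2 ≤ n) (W : Matrix (Fin m) (Fin n) ℝ) (b : Fin m → ℝ)
    (i j : Fin m) (hij : W i ≠ W j) :
    -- the decision boundary is a convex polytope of dimension at most `n - 1`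
    IsConvexPolytope (decisionBoundary W b i j) ∧
    affineDim (decisionBoundary W b i j) ≤ n - 1 ∧
    -- every run of the enumeration stops
    (¬ ∃ S : ℕ → Finset (EuclideanSpace ℝ (Fin n)),
      (boundarySystem W b i j).Start (S 0) ∧ ∀ t, (boundarySystem W b i j).Step (S t) (S (t + 1))) ∧
    -- there is a completed run
    (∃ S, (boundarySystem W b i j).IsOutput S) ∧
    -- every completed run returns exactly the vertices, and the volume is computed from them
    (∀ S, (boundarySystem W b i j).IsOutput S →
      (S : Set (EuclideanSpace ℝ (Fin n))) = (decisionBoundary W b i j).extremePoints ℝ ∧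
      convexHull ℝ (S : Set (EuclideanSpace ℝ (Fin n))) = decisionBoundary W b i j ∧
      ∀ pick : Finset (EuclideanSpace ℝ (Fin n)) → EuclideanSpace ℝ (Fin n),
        (∀ T : Finset (EuclideanSpace ℝ (Fin n)), T.Nonempty → pick T ∈ T) →
        μHE[n - 1] (decisionBoundary W b i j) =
          ENNReal.ofReal (volumeFromVertices (boundarySystem W b i j) pick (n - 1) S)) ∧
    -- the upper bound on the `(n - 1)`-dimensional volume
    ((∀ k, W i k - W j k ≠ 0) →
      μHE[n - 1] (decisionBoundary W b i j) ≤ ENNReal.ofReal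
        (‖(WithLp.toLp 2 (W i - W j) : EuclideanSpace ℝ (Fin n))‖ /
            (((n - 1).factorial : ℝ) * ∏ k, (W i k - W j k)) *
          ∑ K : Finset (Fin n), (-1 : ℝ) ^ K.card *
            (max 0 (-b i + b j - ∑ k ∈ K, (W i k - W j k))) ^ (n - 1))) := by
  have hL := isCompact_feasible_boundarySystem W b i j
  have hP := setOf_feasible_boundarySystem W b i j
  have hface : (boundarySystem W b i j).face ∅ = decisionBoundary W b i j :=
    LinearSystem.face_empty.trans hP
  have hhull := LinearSystem.convexHull_faceVertices hL ∅
  have hdim := affineDim_decisionBoundary_le W b hij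
  rw [hface] at hhull
  refine ⟨⟨_, hhull.symm⟩, hdim, LinearSystem.not_exists_infinite_run,
    LinearSystem.exists_isOutput _, fun S hS => ?_, fun hw => ?_⟩
  · obtain rfl := hS.eq_faceVertices hL
    refine ⟨?_, hhull, fun pick hpick => ?_⟩
    · rw [← hface, LinearSystem.extremePoints_face]
    · rw [← hface]
      exact LinearSystem.euclideanHausdorffMeasure_face hpick hL (hface.symm ▸ hdim)
  · obtain ⟨d, rfl⟩ : ∃ d, n = d + 1 := ⟨n - 1, by omega⟩
    have hd : d ≠ 0 := by omega
    refine (measure_mono (decisionBoundary_subset_hyperplane W b i j)).trans_eq ?_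
    have harea := euclideanHausdorffMeasure_cube_hyperplane hd hw (-b i + b j)
    simp only [alternatingSum, truncPow_eq_max hd] at harea
    exact harea
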